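/- Let $\mathbb{CP}^n=(\mathbb C^{n+1}\setminus\{0\})/\mathbb C^*$ carry the Fubini--Study metric $\langle\,,\rangle$ of constant holomorphic sectional curvature $4$, its complex structure $J$ and its Levi-Civita connection $\nabla$. Let $I\subset\mathbb R$ be a non-empty open interval. A smooth curve $\gamma:I\to\mathbb{CP}^n$ parametrized by arc length is a Frenet curve of osculating order $d$, $1\le d\le 2n$, if there are smooth orthonormal vector fields $E_1=\gamma',E_2,\dots,E_d$ along $\gamma$ and positive functions $k_1,\dots,k_{d-1}$ on $I$ (the curvatures) with $\nabla_{\gamma'}E_i=-k_{i-1}E_{i-1}+k_iE_{i+1}$ for $1\le i\le d$, where the terms with $E_0$ and $E_{d+1}$ are omitted. Its complex torsions are $\tau_{ij}=\langle E_i,JE_j\rangle$, $1\le i<j\le d$. It is a holomorphic helix of order $d$ if all $k_i$ and all $\tau_{ij}$ are constant. With $\tau(\gamma)=\nabla_{\gamma'}\gamma'$ and $R(X,Y)Z=\nabla_X\nabla_YZ-\nabla_Y\nabla_XZ-\nabla_{[X,Y]}Z$, the curve is proper-biharmonic if its bitension field $\tau_2(\gamma)=\nabla_{\gamma'}\nabla_{\gamma'}\tau(\gamma)-R(\gamma',\tau(\gamma))\gamma'$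 vanishes on $I$ while $\tau(\gamma)$ does not vanish identically. **Proposition.** Let $\gamma$ be a proper-biharmonic Frenet curve in $\mathbb{CP}^n$ of osculating order $d=4$. Then $\gamma$ is a holomorphic helix of order $4$, and there is a constant $\alpha_0$ such that $$\tau_{34}=-\tau_{12}=\cos\alpha_0,\qquad \tau_{14}=-\tau_{23}=-\sin\alpha_0,\qquad \tau_{13}=\tau_{24}=0,$$ $$k_3=-\frac{3}{2k_2}\sin(2\alpha_0),\qquad k_1=-\frac{1}{\sin\alpha_0}\,(k_2\cos\alpha_0-k_3\sin\alpha_0),$$ and one of the following holds: (a) $\tau_{12}>0$, $\ \alpha_0\in\bigl(\tfrac{\pi}{2},\ \arccos\bigl(-\tfrac{2-\sqrt3}{\sqrt3}\bigr)\bigr]$, and for one of the two choices of sign $$k_2=\frac{\sin\alpha_0}{\sqrt2}\sqrt{1-3\cos^2\alpha_0\pm\sqrt{9\cos^4\alpha_0-42\cos^2\alpha_0+1}}\,;$$ (b) $\tau_{12}<0$, $\ \alpha_0\in\bigl(\tfrac{3\pi}{2},\ \pi+\arccos\bigl(-\tfrac{2-\sqrt3}{\sqrt3}\bigr)\bigr]$,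 and for one of the two choices of sign $$k_2=-\frac{\sin\alpha_0}{\sqrt2}\sqrt{1-3\cos^2\alpha_0\pm\sqrt{9\cos^4\alpha_0-42\cos^2\alpha_0+1}}\,.$$ -/

import Mathlib

open scoped Manifold ContDiff Topology

noncomputable section

namespace CPn

/-! ### Complex projective space as a smooth manifold -/

/-- Complex projective space `(ℂⁿ⁺¹ ∖ {0}) / ℂ*`. -/
def CP (n : ℕ) : Type := Projectivization ℂ (Fin (n + 1) → ℂ)

/-- The model space `ℂⁿ`; it carries its Hermitian inner product and the underlying real one. -/
abbrev Model (n : ℕ) : Type := EuclideanSpace ℂ (Fin n)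

variable {n : ℕ}

/-- The homogeneous coordinates `(z₁, …, 1, …, zₙ)`, with `1` in position `i`. -/
def homog (i : Fin (n + 1)) (z : Model n) : Fin (n + 1) → ℂ := i.insertNth 1 (fun k => z k)

/-- The affine coordinates `(Z_j / Z_i)_{j ≠ i}` of a point `[Z]`. -/
def affine (i : Fin (n + 1)) (Z : Fin (n + 1) → ℂ) : Model n :=
  WithLp.toLp 2 (fun k => Z (i.succAbove k) / Z i)

@[simp] lemma homog_same (i : Fin (n + 1)) (z : Model n) : homog i z i = 1 := by
  simp [homog]

@[simp] lemma homog_succAbove (i : Fin (n + 1)) (z : Model n) (k : Fin n) :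
    homog i z (i.succAbove k) = z k := by
  simp [homog]

lemma homog_ne_zero (i : Fin (n + 1)) (z : Model n) : homog i z ≠ 0 := fun h => by
  have := congrFun h i
  simp at this

lemma affine_smul (i : Fin (n + 1)) (a : ℂ) (ha : a ≠ 0) (Z : Fin (n + 1) → ℂ) :
    affine i (a • Z) = affine i Z := by
  ext k
  simp [affine, mul_div_mul_left _ _ ha]

lemma affine_homog (i : Fin (n + 1)) (z : Model n) : affine i (homog i z) = z := by
  ext k
  simp [affine]

lemma smul_homog_affine (i : Fin (n + 1)) (Z : Fin (n + 1) → ℂ) (h : Z i ≠ 0) :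
    Z i • homog i (affine i Z) = Z := by
  ext j
  rcases Fin.eq_self_or_eq_succAbove i j with rfl | ⟨k, rfl⟩
  · simp
  · simp [affine, mul_div_cancel₀ _ h]

/-- A homogeneous coordinate vector of a point. -/
def rep (p : CP n) : Fin (n + 1) → ℂ := Projectivization.rep p

/-- The point `[Z]` with homogeneous coordinates `homog i z`. -/
def ofAffine (i : Fin (n + 1)) (z : Model n) : CP n :=
  Projectivization.mk ℂ (homog i z) (homog_ne_zero i z)

lemma rep_ofAffine (i : Fin (n + 1)) (z : Model n) :
    ∃ a : ℂ, a ≠ 0 ∧ rep (ofAffine i z) = a • homog i z := by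
  obtain ⟨a, ha⟩ := Projectivization.exists_smul_eq_mk_rep ℂ (homog i z) (homog_ne_zero i z)
  exact ⟨a, a.ne_zero, ha.symm⟩

lemma ofAffine_affine (i : Fin (n + 1)) (p : CP n) (h : rep p i ≠ 0) :
    ofAffine i (affine i (rep p)) = p := by
  conv_rhs => rw [← Projectivization.mk_rep p]
  exact (Projectivization.mk_eq_mk_iff' ℂ _ _ _ _).2 ⟨(rep p i)⁻¹, by
    change (rep p i)⁻¹ • rep p = _
    conv_lhs => rw [← smul_homog_affine i (rep p) h]
    simp [smul_smul, h]⟩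

/-- The affine chart `[Z] ↦ (Z_j / Z_i)_{j ≠ i}` on `{[Z] | Z_i ≠ 0}`. -/
def affineChart (i : Fin (n + 1)) : PartialEquiv (CP n) (Model n) where
  toFun p := affine i (rep p)
  invFun z := ofAffine i z
  source := {p | rep p i ≠ 0}
  target := Set.univ
  map_source' _ _ := Set.mem_univ _
  map_target' z _ := by
    obtain ⟨a, ha, h⟩ := rep_ofAffine i z
    simp [h, ha]
  left_inv' p hp := ofAffine_affine i p hp
  right_inv' z _ := by
    obtain ⟨a, ha, h⟩ := rep_ofAffine i z
    rw [h, affine_smul i a ha, affine_homog]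

lemma affineChart_trans_source (i j : Fin (n + 1)) :
    ((affineChart i).symm.trans (affineChart j)).source = {z : Model n | homog i z j ≠ 0} := by
  ext z
  obtain ⟨a, ha, h⟩ := rep_ofAffine i z
  simp [PartialEquiv.trans_source, affineChart, h, ha]

lemma affineChart_trans_apply (i j : Fin (n + 1)) (z : Model n) :
    ((affineChart i).symm.trans (affineChart j)) z = affine j (homog i z) := by
  obtain ⟨a, ha, h⟩ := rep_ofAffine i z
  change affine j (rep (ofAffine i z)) = _
  rw [h, affine_smul j a ha]

lemma contDiff_homog (i j : Fin (n + 1)) : ContDiff ℝ ∞ (fun z : Model n => homog i z j) := by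
  rcases Fin.eq_self_or_eq_succAbove i j with rfl | ⟨k, rfl⟩
  · simpa using contDiff_const
  · simp only [homog_succAbove]
    fun_prop

lemma contDiffOn_transition (i j : Fin (n + 1)) :
    ContDiffOn ℝ ∞ (fun z : Model n => affine j (homog i z)) {z | homog i z j ≠ 0} := by
  rw [contDiffOn_piLp]
  intro k
  have h : ContDiffOn ℝ ∞ (fun z : Model n => (homog i z j)⁻¹) {z | homog i z j ≠ 0} :=
    (contDiff_homog i j).contDiffOn.inv fun z hz => hz
  simpa only [affine, div_eq_mul_inv] using (contDiff_homog i _).contDiffOn.mul h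

lemma exists_rep_ne_zero (p : CP n) : ∃ i, rep p i ≠ 0 := by
  by_contra! h
  exact Projectivization.rep_nonzero p (funext h)

/-- The affine charts of complex projective space. -/
def chartCore (n : ℕ) : ChartedSpaceCore (Model n) (CP n) where
  atlas := Set.range affineChart
  chartAt p := affineChart (exists_rep_ne_zero p).choose
  mem_chart_source p := (exists_rep_ne_zero p).choose_spec
  chart_mem_atlas _ := ⟨_, rfl⟩
  open_source := by
    rintro _ _ ⟨i, rfl⟩ ⟨j, rfl⟩
    rw [affineChart_trans_source]
    exact isOpen_ne_fun (contDiff_homog i j).continuous continuous_const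
  continuousOn_toFun := by
    rintro _ _ ⟨i, rfl⟩ ⟨j, rfl⟩
    rw [affineChart_trans_source]
    exact (contDiffOn_transition i j).continuousOn.congr
      fun z _ => affineChart_trans_apply i j z

instance : TopologicalSpace (CP n) := (chartCore n).toTopologicalSpace

instance : ChartedSpace (Model n) (CP n) := (chartCore n).toChartedSpace

instance : IsManifold 𝓘(ℝ, Model n) ∞ (CP n) := by
  apply isManifold_of_contDiffOn
  intro e e' he he'
  have key : ∀ f : OpenPartialHomeomorph (CP n) (Model n), f ∈ atlas (Model n) (CP n) →
      ∃ i, f.toPartialEquiv = affineChart i := by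
    intro f hf
    obtain ⟨_, ⟨g, rfl⟩, hg⟩ := hf
    obtain ⟨_, ⟨⟨i, rfl⟩, rfl⟩, hf⟩ := hg
    exact ⟨i, by rw [Set.mem_singleton_iff.1 hf]; rfl⟩
  obtain ⟨i, hi⟩ := key e he
  obtain ⟨j, hj⟩ := key e' he'
  have hsrc : (e.symm ≫ₕ e').source = {z : Model n | homog i z j ≠ 0} := by
    rw [← affineChart_trans_source, ← hi, ← hj]
    rfl
  have happ : ∀ z, (e.symm ≫ₕ e') z = affine j (homog i z) := by
    intro z
    rw [← affineChart_trans_apply, ← hi, ← hj]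
    rfl
  rw [modelWithCornersSelf_coe, modelWithCornersSelf_coe_symm, Set.range_id, Set.inter_univ,
    Set.preimage_id, hsrc]
  exact (contDiffOn_transition i j).congr fun z _ => happ z

/-! ### Riemannian geometry in a coordinate domain

Here `E` is a finite-dimensional real vector space and `G : E → E →L[ℝ] E →L[ℝ] ℝ` is the
coordinate expression of a Riemannian metric. -/

section Coordinates

variable {E : Type*} [NormedAddCommGroup E] [NormedSpace ℝ E]

/-- The Christoffel symbols of the Levi-Civita connection: `Γ_z(u, v)` is the vector with
`2 G_z(Γ_z(u, v), w) = (∂_u G)(v, w) + (∂_v G)(u, w) - (∂_w G)(u, v)` for all `w`. -/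
def christoffel (G : E → E →L[ℝ] E →L[ℝ] ℝ) (z u v : E) : E :=
  (G z).inverse ((1 / 2 : ℝ) •
    (fderiv ℝ G z u v + fderiv ℝ G z v u - ((fderiv ℝ G z).flip u).flip v))

/-- The curvature tensor `R(u, v)w = ∇_u ∇_v w - ∇_v ∇_u w - ∇_[u, v] w` in coordinates:
`R_z(u, v)w = (∂_u Γ)(v, w) - (∂_v Γ)(u, w) + Γ(u, Γ(v, w)) - Γ(v, Γ(u, w))`. -/
def curvature (G : E → E →L[ℝ] E →L[ℝ] ℝ) (z u v w : E) : E :=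
  fderiv ℝ (fun y => christoffel G y v w) z u - fderiv ℝ (fun y => christoffel G y u w) z v
    + christoffel G z u (christoffel G z v w) - christoffel G z v (christoffel G z u w)

end Coordinates

/-! ### The Fubini-Study structure -/

/-- The Fubini-Study metric of constant holomorphic sectional curvature `4` in affine coordinates:
`G_z(u, v) = Re ((1 + |z|²) ⟨u, v⟩ - ⟨u, z⟩ ⟨z, v⟩) / (1 + |z|²)²`, where `⟨ , ⟩` is the standard
Hermitian product of `ℂⁿ`. The formula is the same in all affine charts. -/
def fubiniStudy (z : Model n) : Model n →L[ℝ] Model n →L[ℝ] ℝ :=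
  (1 + ‖z‖ ^ 2)⁻¹ • innerSL ℝ
    - ((1 + ‖z‖ ^ 2) ^ 2)⁻¹ •
      (innerSL ℝ (E := ℂ)).bilinearComp
        ((innerSL ℂ z).restrictScalars ℝ) ((innerSL ℂ z).restrictScalars ℝ)

lemma fubiniStudy_apply (z u v : Model n) :
    fubiniStudy z u v =
      (((1 + ‖z‖ ^ 2 : ℝ) * inner ℂ u v - inner ℂ u z * inner ℂ z v) /
        ((1 + ‖z‖ ^ 2 : ℝ) : ℂ) ^ 2).re := by
  have hr : (1 + ‖z‖ ^ 2 : ℝ) ≠ 0 := by positivity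
  have h : innerSL ℝ u v = (inner ℂ u v : ℂ).re := by
    change inner ℝ u v = _
    simp [PiLp.inner_apply, Complex.inner]
  rw [← Complex.ofReal_pow, Complex.div_ofReal_re, Complex.sub_re, Complex.re_ofReal_mul,
    ← inner_conj_symm u z]
  simp only [fubiniStudy, sub_apply, smul_apply, h,
    innerSL_apply_apply, ContinuousLinearMap.bilinearComp_apply, smul_eq_mul,
    ContinuousLinearMap.coe_restrictScalars', Complex.inner, Complex.mul_re, Complex.conj_re,
    Complex.conj_im]
  field_simp

/-- The tangent space of `CP n` at `p`. Its elements are written in the coordinates of the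
preferred affine chart around `p`. -/
abbrev Tangent (p : CP n) : Type := TangentSpace 𝓘(ℝ, Model n) p

/-- The components of a tangent vector at `p` in the preferred affine chart around `p`. -/
def components {p : CP n} (u : Tangent p) : Model n := u

/-- The tangent vector at `p` with given components in the preferred affine chart around `p`. -/
def ofComponents (p : CP n) (u : Model n) : Tangent p := u

/-- The coordinates of a point `q` in the preferred affine chart around `p`. -/
def coord (p q : CP n) : Model n := extChartAt 𝓘(ℝ, Model n) p q

/-- The Fubini-Study metric on the tangent space at `p`. -/
def metric (p : CP n) (u v : Tangent p) : ℝ :=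
  fubiniStudy (coord p p) (components u) (components v)

/-- The complex structure on the tangent space at `p`. -/
def complexStructure (p : CP n) (u : Tangent p) : Tangent p :=
  ofComponents p (Complex.I • components u)

/-- The Riemann curvature tensor `R(u, v)w` of the Fubini-Study metric at `p`. -/
def riemann (p : CP n) (u v w : Tangent p) : Tangent p :=
  ofComponents p
    (curvature fubiniStudy (coord p p) (components u) (components v) (components w))

/-! ### Curves and vector fields along curves -/

/-- A vector field along a curve. -/
abbrev FieldAlong (γ : ℝ → CP n) : Type := ∀ s : ℝ, Tangent (γ s)

/-- Smoothness of a vector field along a curve on the set `I` of parameters. -/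
def SmoothField (I : Set ℝ) (γ : ℝ → CP n) (V : FieldAlong γ) : Prop :=
  ContMDiffOn 𝓘(ℝ, ℝ) 𝓘(ℝ, Model n).tangent ∞
    (fun s => (⟨γ s, V s⟩ : TangentBundle 𝓘(ℝ, Model n) (CP n))) I

/-- The velocity field of a curve. -/
def velocity (γ : ℝ → CP n) : FieldAlong γ := fun s => mfderiv 𝓘(ℝ, ℝ) 𝓘(ℝ, Model n) γ s (1 : ℝ)

/-- The coordinates of the curve `γ` in the preferred affine chart around `γ s`. -/
def localCurve (γ : ℝ → CP n) (s t : ℝ) : Model n := coord (γ s) (γ t)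

/-- The components of the field `V` in the preferred affine chart around `γ s`. -/
def localField (γ : ℝ → CP n) (V : FieldAlong γ) (s t : ℝ) : Model n :=
  tangentCoordChange 𝓘(ℝ, Model n) (γ t) (γ s) (γ t) (components (V t))

/-- The covariant derivative `∇_{γ'} V` of the Levi-Civita connection of the Fubini-Study metric:
in coordinates, `V' + Γ(γ', V)`. -/
def covDeriv (γ : ℝ → CP n) (V : FieldAlong γ) : FieldAlong γ := fun s =>
  ofComponents (γ s) (deriv (localField γ V s) s
    + christoffel fubiniStudy (localCurve γ s s) (deriv (localCurve γ s) s) (localField γ V s s))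

/-- The tension field of a curve, `τ(γ) = trace ∇dγ = ∇_{γ'} γ'`. -/
def tension (γ : ℝ → CP n) : FieldAlong γ := covDeriv γ (velocity γ)

/-- The bitension field of a curve,
`τ₂(γ) = -Δτ(γ) - trace R(dγ, τ(γ))dγ = ∇_{γ'} ∇_{γ'} τ(γ) - R(γ', τ(γ))γ'`. -/
def bitension (γ : ℝ → CP n) : FieldAlong γ := fun s =>
  covDeriv γ (covDeriv γ (tension γ)) s - riemann (γ s) (velocity γ s) (tension γ s) (velocity γ s)

/-- Proper-biharmonic curves: biharmonic and not harmonic. -/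
def IsProperBiharmonic (I : Set ℝ) (γ : ℝ → CP n) : Prop :=
  (∀ s ∈ I, bitension γ s = 0) ∧ ¬ ∀ s ∈ I, tension γ s = 0

/-- `γ` is, on the parameter interval `I`, a smooth Frenet curve of osculating order `d`,
parametrized by arc length, with Frenet frame `E 1, …, E d` and curvatures `k 1, …, k (d - 1)`.
The values of `E` and `k` at other indices play no role. -/
structure IsFrenetCurve (I : Set ℝ) (γ : ℝ → CP n) (d : ℕ) (E : ℕ → FieldAlong γ)
    (k : ℕ → ℝ → ℝ) : Prop where
  order : 1 ≤ d ∧ d ≤ 2 * n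
  smooth : ContMDiffOn 𝓘(ℝ, ℝ) 𝓘(ℝ, Model n) ∞ γ I
  smooth_frame : ∀ i ∈ Finset.Icc 1 d, SmoothField I γ (E i)
  velocity_eq : ∀ s ∈ I, E 1 s = velocity γ s
  orthonormal : ∀ s ∈ I, ∀ i ∈ Finset.Icc 1 d, ∀ j ∈ Finset.Icc 1 d,
    metric (γ s) (E i s) (E j s) = if i = j then 1 else 0
  curvature_pos : ∀ i ∈ Finset.Icc 1 (d - 1), ∀ s ∈ I, 0 < k i s
  frenet : ∀ s ∈ I, ∀ i ∈ Finset.Icc 1 d, covDeriv γ (E i) s =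
    (if i = 1 then 0 else -(k (i - 1) s) • E (i - 1) s)
      + (if i = d then 0 else k i s • E (i + 1) s)

/-- The complex torsions `τ_ij = ⟨E_i, J E_j⟩`. -/
def torsion (γ : ℝ → CP n) (E : ℕ → FieldAlong γ) (i j : ℕ) (s : ℝ) : ℝ :=
  metric (γ s) (E i s) (complexStructure (γ s) (E j s))

/-- A holomorphic helix of order `d`: a Frenet curve of osculating order `d` with constant
curvatures and constant complex torsions. -/
structure IsHolomorphicHelix (I : Set ℝ) (γ : ℝ → CP n) (d : ℕ) (E : ℕ → FieldAlong γ)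
    (k : ℕ → ℝ → ℝ) : Prop where
  frenet : IsFrenetCurve I γ d E k
  curvature_const : ∀ i ∈ Finset.Icc 1 (d - 1), ∃ c : ℝ, 0 < c ∧ ∀ s ∈ I, k i s = c
  torsion_const : ∀ i j, 1 ≤ i → i < j → j ≤ d → ∃ c : ℝ, ∀ s ∈ I, torsion γ E i j s = c

end CPn

end

open scoped Manifold ContDiff Topology

noncomputable section

namespace CPn

variable {n : ℕ}

/-! ### The Fubini-Study metric in affine coordinates -/

/-! The geometric input is that the Fubini-Study metric is Kähler with the curvature tensor of
constant holomorphic sectional curvature 4. In an affine chart the connection is `Γ(u, v) = -(ℓ(u) v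
+ ℓ(v) u)` with `ℓ = ∂ log (1 + |z|²)` (`christoffel_fubiniStudy`). From this come `∇J = 0`, metric
compatibility, and `R(u, v)u = -v + 3⟨u, Jv⟩ Ju` for a unit `u` orthogonal to `v`. Covariant
derivatives along a curve are taken at each parameter in the chart preferred there, so chart
independence (`localField_covDeriv`) is needed before they can be differentiated again.

For a Frenet curve of order four, biharmonicity then states that an explicit combination of `E_1, …,
E_4` equals `3 k_1 τ_12 J E_1` (`biharmonic_eq`). Pairing it with the frame, with `J E_1` and with
`J E_3` gives `k_1' = 0`, `k_1² + k_2² = 1 + 3τ_12²`, `k_2' = -3τ_12 τ_13`, `k_2 k_3 = -3τ_12 τ_14`,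
`τ_12² + τ_13² + τ_14² = 1` and `τ_12 τ_23 = τ_14 τ_34`. The second and third, with `τ_12' = k_2
τ_13`, force `τ_13 = 0`. Differentiating the unit relation then forces `τ_24 = 0`. Hence `k_2`,
`τ_12`, `τ_14` are constant, and the remaining quantities are determined by them
(`biharmonic_const`).

What is left is algebra. Positivity of the curvatures fixes the signs `τ_23 = -τ_14`, `τ_34 =
-τ_12`, so `(-τ_12, -τ_14)` is the point of angle `α` on the unit circle (`exists_angle`).
Eliminating `k_1` and `k_3` leaves a quadratic for `(k_2 / sin α)²`, whose real solvability bounds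
`α` (`exists_sign_of_quadratic`). -/

/-- The function `1 + |z|²`, as a complex number. -/
def rho (z : Model n) : ℂ := 1 + inner ℂ z z

lemma rho_eq (z : Model n) : rho z = ((1 + ‖z‖ ^ 2 : ℝ) : ℂ) := by
  rw [rho, inner_self_eq_norm_sq_to_K]; push_cast; rfl

lemma rho_ne_zero (z : Model n) : rho z ≠ 0 := by
  rw [rho_eq, Complex.ofReal_ne_zero]; positivity

lemma conj_rho (z : Model n) : (starRingEnd ℂ) (rho z) = rho z := by
  rw [rho_eq, Complex.conj_ofReal]

/-- The Hermitian form whose real part is the Fubini-Study metric. -/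
def fsHerm (z u v : Model n) : ℂ :=
  (rho z * inner ℂ u v - inner ℂ u z * inner ℂ z v) / rho z ^ 2

lemma fubiniStudy_eq_re (z u v : Model n) : fubiniStudy z u v = (fsHerm z u v).re := by
  rw [fubiniStudy_apply, fsHerm, rho_eq]

lemma conj_fsHerm (z u v : Model n) : (starRingEnd ℂ) (fsHerm z u v) = fsHerm z v u := by
  simp only [fsHerm, map_div₀, map_sub, map_mul, map_pow, conj_rho, inner_conj_symm]
  ring

lemma fsHerm_smul_right (z u v : Model n) (c : ℂ) : fsHerm z u (c • v) = c * fsHerm z u v := by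
  simp only [fsHerm, inner_smul_right]; ring

lemma fsHerm_smul_left (z u v : Model n) (c : ℂ) :
    fsHerm z (c • u) v = (starRingEnd ℂ) c * fsHerm z u v := by
  rw [← conj_fsHerm, fsHerm_smul_right, map_mul, conj_fsHerm]

lemma fubiniStudy_symm (z u v : Model n) : fubiniStudy z u v = fubiniStudy z v u := by
  rw [fubiniStudy_eq_re, fubiniStudy_eq_re, ← conj_fsHerm, Complex.conj_re]

lemma fubiniStudy_I_I (z u v : Model n) :
    fubiniStudy z (Complex.I • u) (Complex.I • v) = fubiniStudy z u v := by
  simp only [fubiniStudy_eq_re, fsHerm_smul_left, fsHerm_smul_right, ← mul_assoc]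
  simp

/-- By Cauchy-Schwarz the numerator `(1 + |z|²)|u|² - |⟨z, u⟩|²` is at least `|u|²`. -/
lemma fubiniStudy_self_pos (z u : Model n) (hu : u ≠ 0) : 0 < fubiniStudy z u u := by
  have hr : (0 : ℝ) < 1 + ‖z‖ ^ 2 := by positivity
  have hcs : ‖(inner ℂ z u : ℂ)‖ ^ 2 ≤ ‖z‖ ^ 2 * ‖u‖ ^ 2 := by
    rw [← mul_pow]
    exact pow_le_pow_left₀ (norm_nonneg _) (norm_inner_le_norm z u) 2
  have hu' : 0 < ‖u‖ ^ 2 := by have := norm_pos_iff.2 hu; positivity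
  have h : fubiniStudy z u u
      = ((1 + ‖z‖ ^ 2) * ‖u‖ ^ 2 - ‖(inner ℂ z u : ℂ)‖ ^ 2) / (1 + ‖z‖ ^ 2) ^ 2 := by
    rw [fubiniStudy_apply, ← inner_conj_symm u z, mul_comm ((starRingEnd ℂ) _), Complex.mul_conj,
      inner_self_eq_norm_sq_to_K, Complex.normSq_eq_norm_sq, ← Complex.ofReal_re (_ / _)]
    congr 1
    push_cast
    rfl
  rw [h]
  apply div_pos _ (by positivity)
  nlinarith

/-- Needed because `christoffel` is defined with `ContinuousLinearMap.inverse`, which is the zero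
map at a non-invertible argument. Positivity gives injectivity, and a space and its dual have equal
dimension. -/
lemma fubiniStudy_isInvertible (z : Model n) : (fubiniStudy z).IsInvertible := by
  have hinj : Function.Injective (fubiniStudy z).toLinearMap := by
    rw [← LinearMap.ker_eq_bot, LinearMap.ker_eq_bot']
    intro u hu
    by_contra h
    have := fubiniStudy_self_pos z u h
    have h0 : fubiniStudy z u = 0 := hu
    simp [h0] at this
  have hdim : Module.finrank ℝ (Model n) = Module.finrank ℝ (Model n →L[ℝ] ℝ) := by
    rw [← (LinearMap.toContinuousLinearMap (𝕜 := ℝ) (E := Model n) (F' := ℝ)).finrank_eq]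
    exact (Subspace.dual_finrank_eq (K := ℝ) (V := Model n)).symm
  refine ⟨(LinearEquiv.ofInjectiveOfFinrankEq (fubiniStudy z).toLinearMap hinj
    hdim).toContinuousLinearEquiv, ?_⟩
  ext u v
  rfl

lemma contDiff_rho : ContDiff ℝ ∞ (rho : Model n → ℂ) := by
  unfold rho
  exact contDiff_const.add (contDiff_id.inner ℂ contDiff_id)

lemma contDiff_fsHerm (u v : Model n) : ContDiff ℝ ∞ (fun z => fsHerm z u v) := by
  unfold fsHerm
  simp only [div_eq_mul_inv]
  exact ((contDiff_rho.mul contDiff_const).sub ((contDiff_const.inner ℂ contDiff_id).mul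
    (contDiff_id.inner ℂ contDiff_const))).mul ((contDiff_rho.pow 2).inv
    fun z => pow_ne_zero 2 (rho_ne_zero z))

lemma contDiff_fubiniStudy : ContDiff ℝ ∞ (fubiniStudy : Model n → _) := by
  rw [contDiff_clm_apply_iff]
  intro u
  rw [contDiff_clm_apply_iff]
  intro v
  simp only [fubiniStudy_eq_re]
  exact Complex.reCLM.contDiff.comp (contDiff_fsHerm u v)

/-! ### Derivative of the metric, Christoffel symbols and curvature -/

lemma hasDerivAt_fsHerm {x : ℝ → Model n} {u : Model n} {s : ℝ} (hx : HasDerivAt x u s)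
    (v w : Model n) :
    HasDerivAt (fun t => fsHerm (x t) v w)
      (((inner ℂ (x s) u + inner ℂ u (x s)) * inner ℂ v w - (inner ℂ v (x s) * inner ℂ u w
          + inner ℂ v u * inner ℂ (x s) w)) / rho (x s) ^ 2
        - 2 * (inner ℂ (x s) u + inner ℂ u (x s)) * (rho (x s) * inner ℂ v w
          - inner ℂ v (x s) * inner ℂ (x s) w) / rho (x s) ^ 3) s := by
  have hr : HasDerivAt (fun t => rho (x t)) (inner ℂ (x s) u + inner ℂ u (x s)) s := by
    simpa [rho] using (hx.inner ℂ hx).const_add (1 : ℂ)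
  have h1 : HasDerivAt (fun t => (inner ℂ v (x t) : ℂ)) (inner ℂ v u) s := by
    simpa using (hasDerivAt_const s v).inner ℂ hx
  have h2 : HasDerivAt (fun t => (inner ℂ (x t) w : ℂ)) (inner ℂ u w) s := by
    simpa using hx.inner ℂ (hasDerivAt_const s w)
  have h0 := rho_ne_zero (x s)
  refine (((hr.mul_const (inner ℂ v w)).sub (h1.mul h2)).div (hr.pow 2)
    (pow_ne_zero 2 h0)).congr_deriv ?_
  simp only [Pi.sub_apply, Pi.mul_apply]
  field_simp
  simp
  ring

lemma hasDerivAt_clm_apply_const {E F : Type*} [NormedAddCommGroup E] [NormedSpace ℝ E]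
    [NormedAddCommGroup F] [NormedSpace ℝ F] {A : ℝ → E →L[ℝ] F} {A' : E →L[ℝ] F} {s : ℝ}
    (h : HasDerivAt A A' s) (v : E) : HasDerivAt (fun t => A t v) (A' v) s := by
  simpa using h.clm_apply (hasDerivAt_const s v)

lemma fderiv_fubiniStudy (z u v w : Model n) :
    fderiv ℝ fubiniStudy z u v w =
      (((inner ℂ z u + inner ℂ u z) * inner ℂ v w - (inner ℂ v z * inner ℂ u w
          + inner ℂ v u * inner ℂ z w)) / rho z ^ 2
        - 2 * (inner ℂ z u + inner ℂ u z) * (rho z * inner ℂ v w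
          - inner ℂ v z * inner ℂ z w) / rho z ^ 3).re := by
  have hx : HasDerivAt (fun t : ℝ => z + t • u) u 0 := by
    simpa using ((hasDerivAt_id (0 : ℝ)).smul_const u).const_add z
  have hG : HasFDerivAt fubiniStudy (fderiv ℝ fubiniStudy z) (z + (0 : ℝ) • u) := by
    rw [zero_smul, add_zero]
    exact ((contDiff_fubiniStudy (n := n)).differentiable (by simp) z).hasFDerivAt
  have h0 : HasDerivAt (fun t : ℝ => fubiniStudy (z + t • u)) (fderiv ℝ fubiniStudy z u) 0 :=
    HasFDerivAt.comp_hasDerivAt (E := Model n →L[ℝ] Model n →L[ℝ] ℝ) (0 : ℝ)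
      (l := fubiniStudy) (f := fun t : ℝ => z + t • u) hG hx
  have h1 : HasDerivAt (fun t : ℝ => fubiniStudy (z + t • u) v w)
      (fderiv ℝ fubiniStudy z u v w) 0 :=
    hasDerivAt_clm_apply_const (hasDerivAt_clm_apply_const h0 v) w
  have h2 : HasDerivAt (fun t : ℝ => fubiniStudy (z + t • u) v w) _ 0 :=
    (Complex.reCLM.hasFDerivAt.comp_hasDerivAt (0 : ℝ)
      (hasDerivAt_fsHerm hx v w)).congr_of_eventuallyEq (.of_forall fun t => by
      exact fubiniStudy_eq_re _ _ _)
  rw [h1.unique h2, Complex.reCLM_apply, zero_smul, add_zero]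

/-- The complex 1-form `∂ log (1 + |z|²)`. -/
def logForm (z u : Model n) : ℂ := inner ℂ z u / rho z

/-- The proposed vector satisfies the Koszul identity, and the metric is invertible. -/
lemma christoffel_fubiniStudy (z u v : Model n) :
    christoffel fubiniStudy z u v = -(logForm z u • v + logForm z v • u) := by
  have h : (1 / 2 : ℝ) • (fderiv ℝ fubiniStudy z u v + fderiv ℝ fubiniStudy z v u
      - ((fderiv ℝ fubiniStudy z).flip u).flip v)
      = fubiniStudy z (-(logForm z u • v + logForm z v • u)) := by
    ext w
    simp only [smul_apply, add_apply, sub_apply, ContinuousLinearMap.flip_apply,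
      fderiv_fubiniStudy, smul_eq_mul, fubiniStudy_eq_re, fsHerm, logForm, inner_neg_left,
      inner_add_left, inner_smul_left, map_div₀, conj_rho]
    have h0 := rho_ne_zero z
    rw [← Complex.add_re, ← Complex.sub_re, ← Complex.re_ofReal_mul]
    refine Complex.ofReal_injective ?_
    -- The identity holds for real parts but not for the Hermitian expressions themselves. Writing
    -- `Re x` as half of `x + conj x` makes it a rational identity between inner products.
    rw [Complex.re_eq_add_conj, Complex.re_eq_add_conj]
    simp only [map_sub, map_mul, map_div₀, map_add, map_neg, map_pow, conj_rho, inner_conj_symm,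
      Complex.conj_ofReal, map_ofNat]
    push_cast
    field_simp
    ring
  rw [christoffel, h, (fubiniStudy_isInvertible z).inverse_apply_eq]

/-- The Hermitian form of the Fubini-Study metric is the differential of `logForm` up to a
quadratic term. -/
lemma hasDerivAt_logForm {x : ℝ → Model n} {u : Model n} {s : ℝ} (hx : HasDerivAt x u s)
    (v : Model n) :
    HasDerivAt (fun t => logForm (x t) v)
      (fsHerm (x s) u v - logForm (x s) u * logForm (x s) v) s := by
  have hr : HasDerivAt (fun t => rho (x t)) (inner ℂ (x s) u + inner ℂ u (x s)) s := by
    simpa [rho] using (hx.inner ℂ hx).const_add (1 : ℂ)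
  have h2 : HasDerivAt (fun t => (inner ℂ (x t) v : ℂ)) (inner ℂ u v) s := by
    simpa using hx.inner ℂ (hasDerivAt_const s v)
  have h0 := rho_ne_zero (x s)
  refine (h2.div hr h0).congr_deriv ?_
  simp only [logForm, fsHerm]
  field_simp
  ring

lemma contDiff_logForm (v : Model n) : ContDiff ℝ ∞ (fun z => logForm z v) := by
  simp only [logForm, div_eq_mul_inv]
  exact (contDiff_id.inner ℂ contDiff_const).mul (contDiff_rho.inv rho_ne_zero)

lemma logForm_add (z u v : Model n) : logForm z (u + v) = logForm z u + logForm z v := by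
  simp only [logForm, inner_add_right]; ring

lemma logForm_smul (z u : Model n) (c : ℂ) : logForm z (c • u) = c * logForm z u := by
  simp only [logForm, inner_smul_right]; ring

lemma logForm_neg (z u : Model n) : logForm z (-u) = -logForm z u := by
  simp only [logForm, inner_neg_right]; ring

lemma fderiv_christoffel_fubiniStudy (z u v w : Model n) :
    fderiv ℝ (fun y => christoffel fubiniStudy y v w) z u =
      -((fsHerm z u v - logForm z u * logForm z v) • w
        + (fsHerm z u w - logForm z u * logForm z w) • v) := by
  have hx : HasDerivAt (fun t : ℝ => z + t • u) u 0 := by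
    simpa using ((hasDerivAt_id (0 : ℝ)).smul_const u).const_add z
  have hd : ContDiff ℝ ∞ (fun y => christoffel fubiniStudy y v w) := by
    simp only [christoffel_fubiniStudy]
    exact (((contDiff_logForm v).smul contDiff_const).add
      ((contDiff_logForm w).smul contDiff_const)).neg
  have h1 : HasDerivAt (fun t : ℝ => christoffel fubiniStudy (z + t • u) v w)
      (fderiv ℝ (fun y => christoffel fubiniStudy y v w) z u) 0 := by
    refine HasFDerivAt.comp_hasDerivAt_of_eq (0 : ℝ)
      (l := fun y => christoffel fubiniStudy y v w)
      (hd.differentiable (by simp) z).hasFDerivAt hx (by simp)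
  have h2 := (((hasDerivAt_logForm hx v).smul_const w).add
    ((hasDerivAt_logForm hx w).smul_const v)).neg
  simp only [zero_smul, add_zero] at h2
  refine h1.unique (h2.congr_of_eventuallyEq (.of_forall fun t => ?_))
  exact christoffel_fubiniStudy _ _ _

/-- The products of two `logForm`s in `∂Γ` cancel those in `Γ ∘ Γ`, so only the Hermitian form
survives. -/
lemma curvature_fubiniStudy (z u v w : Model n) :
    curvature fubiniStudy z u v w =
      (fsHerm z v u - fsHerm z u v) • w - fsHerm z u w • v + fsHerm z v w • u := by
  simp only [curvature, fderiv_christoffel_fubiniStudy]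
  simp only [christoffel_fubiniStudy, logForm_neg, logForm_add, logForm_smul]
  module

/-- The curvature operator of a metric of constant holomorphic sectional curvature `4`. -/
lemma curvature_fubiniStudy_of_orthonormal (z u v : Model n) (hu : fubiniStudy z u u = 1)
    (huv : fubiniStudy z u v = 0) :
    curvature fubiniStudy z u v u =
      -v + (3 * fubiniStudy z u (Complex.I • v)) • (Complex.I • u) := by
  have h1 : fsHerm z u u = 1 := by
    have h : (fsHerm z u u).im = 0 := by
      rw [← Complex.conj_eq_iff_im, conj_fsHerm]
    rw [fubiniStudy_eq_re] at hu
    exact Complex.ext hu h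
  -- Orthogonality kills the real part of the Hermitian form; its imaginary part is read off from
  -- the pairing of `u` with `i v`.
  have h2 : fsHerm z u v = -(fubiniStudy z u (Complex.I • v)) * Complex.I := by
    rw [fubiniStudy_eq_re] at huv
    rw [fubiniStudy_eq_re, fsHerm_smul_right]
    apply Complex.ext <;> simp [huv]
  have h3 : fsHerm z v u = fubiniStudy z u (Complex.I • v) * Complex.I := by
    rw [← conj_fsHerm, h2]; simp
  rw [curvature_fubiniStudy, h1, h2, h3, ← Complex.coe_smul, smul_smul]
  push_cast
  module

/-! ### Changes of affine charts -/

/-- The linear part of `homog i`. -/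
def dhomog (i : Fin (n + 1)) (u : Model n) : Fin (n + 1) → ℂ := i.insertNth 0 (fun k => u k)

/-- The derivative of `affine j` at `X` in the direction `U`. -/
def dAffine (j : Fin (n + 1)) (X U : Fin (n + 1) → ℂ) : Model n :=
  WithLp.toLp 2 (fun k => U (j.succAbove k) / X j - X (j.succAbove k) * U j / X j ^ 2)

@[simp] lemma dhomog_same (i : Fin (n + 1)) (u : Model n) : dhomog i u i = 0 := by
  simp [dhomog]

@[simp] lemma dhomog_succAbove (i : Fin (n + 1)) (u : Model n) (k : Fin n) :
    dhomog i u (i.succAbove k) = u k := by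
  simp [dhomog]

@[simp] lemma dAffine_apply (j : Fin (n + 1)) (X U : Fin (n + 1) → ℂ) (k : Fin n) :
    dAffine j X U k = U (j.succAbove k) / X j - X (j.succAbove k) * U j / X j ^ 2 := rfl

@[simp] lemma affine_apply (j : Fin (n + 1)) (X : Fin (n + 1) → ℂ) (k : Fin n) :
    affine j X k = X (j.succAbove k) / X j := rfl

lemma dhomog_add (i : Fin (n + 1)) (u v : Model n) :
    dhomog i (u + v) = dhomog i u + dhomog i v := by
  ext k
  rcases Fin.eq_self_or_eq_succAbove i k with rfl | ⟨k, rfl⟩ <;> simp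

lemma dhomog_smul (i : Fin (n + 1)) (c : ℂ) (u : Model n) :
    dhomog i (c • u) = c • dhomog i u := by
  ext k
  rcases Fin.eq_self_or_eq_succAbove i k with rfl | ⟨k, rfl⟩ <;> simp

lemma dAffine_add (j : Fin (n + 1)) (X U V : Fin (n + 1) → ℂ) :
    dAffine j X (U + V) = dAffine j X U + dAffine j X V := by
  ext k
  simp
  ring

lemma dAffine_smul (j : Fin (n + 1)) (X U : Fin (n + 1) → ℂ) (c : ℂ) :
    dAffine j X (c • U) = c • dAffine j X U := by
  ext k
  simp
  ring

lemma homog_affine (j : Fin (n + 1)) (X : Fin (n + 1) → ℂ) (h : X j ≠ 0) :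
    homog j (affine j X) = (X j)⁻¹ • X := by
  rw [eq_inv_smul_iff₀ h, smul_homog_affine j X h]

lemma dhomog_dAffine (j : Fin (n + 1)) (X U : Fin (n + 1) → ℂ) (h : X j ≠ 0) :
    dhomog j (dAffine j X U) = (X j)⁻¹ • U - (U j / X j ^ 2) • X := by
  ext k
  rcases Fin.eq_self_or_eq_succAbove j k with rfl | ⟨k, rfl⟩
  · simp; field_simp; simp
  · simp; field_simp

/-- The standard Hermitian product on the space of homogeneous coordinates. -/
def hprod (X Y : Fin (n + 1) → ℂ) : ℂ := star X ⬝ᵥ Y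

lemma hprod_homog (i : Fin (n + 1)) (z : Model n) : hprod (homog i z) (homog i z) = rho z := by
  simp [hprod, dotProduct, Fin.sum_univ_succAbove _ i, rho, PiLp.inner_apply, mul_comm,
    -inner_self_eq_norm_sq_to_K]

lemma hprod_homog_dhomog (i : Fin (n + 1)) (z u : Model n) :
    hprod (homog i z) (dhomog i u) = inner ℂ z u := by
  simp [hprod, dotProduct, Fin.sum_univ_succAbove _ i, PiLp.inner_apply, mul_comm]

lemma hprod_dhomog_homog (i : Fin (n + 1)) (u z : Model n) :
    hprod (dhomog i u) (homog i z) = inner ℂ u z := by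
  simp [hprod, dotProduct, Fin.sum_univ_succAbove _ i, PiLp.inner_apply, mul_comm]

lemma hprod_dhomog_dhomog (i : Fin (n + 1)) (u v : Model n) :
    hprod (dhomog i u) (dhomog i v) = inner ℂ u v := by
  simp [hprod, dotProduct, Fin.sum_univ_succAbove _ i, PiLp.inner_apply, mul_comm]

lemma hprod_sub_left (X Y Z : Fin (n + 1) → ℂ) : hprod (X - Y) Z = hprod X Z - hprod Y Z := by
  simp [hprod, sub_dotProduct]

lemma hprod_sub_right (X Y Z : Fin (n + 1) → ℂ) : hprod X (Y - Z) = hprod X Y - hprod X Z := by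
  simp [hprod, dotProduct_sub]

lemma hprod_smul_left (c : ℂ) (X Y : Fin (n + 1) → ℂ) :
    hprod (c • X) Y = (starRingEnd ℂ) c * hprod X Y := by
  simp [hprod, smul_dotProduct]

lemma hprod_smul_right (c : ℂ) (X Y : Fin (n + 1) → ℂ) : hprod X (c • Y) = c * hprod X Y := by
  simp [hprod, dotProduct_smul]

lemma rho_affine (j : Fin (n + 1)) (X : Fin (n + 1) → ℂ) (h : X j ≠ 0) :
    rho (affine j X) = (starRingEnd ℂ) (X j)⁻¹ * (X j)⁻¹ * hprod X X := by
  rw [← hprod_homog j, homog_affine j X h, hprod_smul_left, hprod_smul_right, mul_assoc]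

lemma hprod_self_ne_zero (j : Fin (n + 1)) (X : Fin (n + 1) → ℂ) (h : X j ≠ 0) :
    hprod X X ≠ 0 := by
  intro h0
  exact rho_ne_zero (affine j X) (by rw [rho_affine j X h, h0, mul_zero])

/-- Since `1 + |z|² = |X|² / |X_j|²`, the form is `∂ log |X|²` minus `d log X_j`. Only the last term
depends on the chart. -/
lemma logForm_dAffine (j : Fin (n + 1)) (X U : Fin (n + 1) → ℂ) (h : X j ≠ 0) :
    logForm (affine j X) (dAffine j X U) = hprod X U / hprod X X - U j / X j := by
  have h0 := hprod_self_ne_zero j X h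
  have h1 : (starRingEnd ℂ) (X j) ≠ 0 := by simpa using h
  rw [logForm, rho_affine j X h, ← hprod_homog_dhomog j, homog_affine j X h,
    dhomog_dAffine j X U h]
  simp only [hprod_sub_right, hprod_smul_left, hprod_smul_right, map_inv₀]
  field_simp

/-- The right-hand side does not involve `j`; this is why the coordinate formula for the metric is
the same in all affine charts. -/
lemma fsHerm_dAffine (j : Fin (n + 1)) (X U V : Fin (n + 1) → ℂ) (h : X j ≠ 0) :
    fsHerm (affine j X) (dAffine j X U) (dAffine j X V) =
      (hprod X X * hprod U V - hprod U X * hprod X V) / hprod X X ^ 2 := by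
  have h0 := hprod_self_ne_zero j X h
  have h1 : (starRingEnd ℂ) (X j) ≠ 0 := by simpa using h
  rw [fsHerm, rho_affine j X h, ← hprod_homog_dhomog j (affine j X),
    ← hprod_dhomog_homog j (dAffine j X U) (affine j X),
    ← hprod_dhomog_dhomog j, homog_affine j X h, dhomog_dAffine j X U h, dhomog_dAffine j X V h]
  simp only [hprod_sub_right, hprod_sub_left, hprod_smul_left, hprod_smul_right, map_inv₀,
    map_div₀, map_pow]
  field_simp
  ring

/-- The change from the `i`-th to the `j`-th affine chart. -/
def transition (i j : Fin (n + 1)) (z : Model n) : Model n := affine j (homog i z)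

/-- The derivative of the change of charts. -/
def dTransition (i j : Fin (n + 1)) (z u : Model n) : Model n :=
  dAffine j (homog i z) (dhomog i u)

lemma dTransition_add (i j : Fin (n + 1)) (z u v : Model n) :
    dTransition i j z (u + v) = dTransition i j z u + dTransition i j z v := by
  simp only [dTransition, dhomog_add, dAffine_add]

lemma dTransition_smul (i j : Fin (n + 1)) (z u : Model n) (c : ℂ) :
    dTransition i j z (c • u) = c • dTransition i j z u := by
  simp only [dTransition, dhomog_smul, dAffine_smul]

lemma fubiniStudy_dTransition (i j : Fin (n + 1)) (z u v : Model n) (h : homog i z j ≠ 0) :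
    fubiniStudy (transition i j z) (dTransition i j z u) (dTransition i j z v) =
      fubiniStudy z u v := by
  rw [fubiniStudy_eq_re, fubiniStudy_eq_re, transition, dTransition, dTransition,
    fsHerm_dAffine j _ _ _ h, hprod_homog, hprod_homog_dhomog, hprod_dhomog_homog,
    hprod_dhomog_dhomog, fsHerm]

lemma logForm_dTransition (i j : Fin (n + 1)) (z u : Model n) (h : homog i z j ≠ 0) :
    logForm (transition i j z) (dTransition i j z u) =
      logForm z u - dhomog i u j / homog i z j := by
  rw [transition, dTransition, logForm_dAffine j _ _ h, hprod_homog, hprod_homog_dhomog, logForm]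

/-! ### Differentiating chart changes along curves -/

lemma hasDerivAt_model {f : ℝ → Model n} {f' : Model n} {s : ℝ}
    (h : ∀ k, HasDerivAt (fun t => f t k) (f' k) s) : HasDerivAt f f' s := by
  have h1 : HasDerivAt (fun t => WithLp.ofLp (f t)) (WithLp.ofLp f') s := hasDerivAt_pi.2 h
  exact (PiLp.continuousLinearEquiv 2 ℝ (fun _ : Fin n => ℂ)).symm.hasFDerivAt.comp_hasDerivAt s h1

lemma _root_.HasDerivAt.model_apply {f : ℝ → Model n} {f' : Model n} {s : ℝ}
    (h : HasDerivAt f f' s) (k : Fin n) : HasDerivAt (fun t => f t k) (f' k) s :=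
  (PiLp.proj (𝕜 := ℝ) 2 (fun _ : Fin n => ℂ) k).hasFDerivAt.comp_hasDerivAt s h

lemma hasDerivAt_homog (i k : Fin (n + 1)) {x : ℝ → Model n} {x' : Model n} {s : ℝ}
    (hx : HasDerivAt x x' s) : HasDerivAt (fun t => homog i (x t) k) (dhomog i x' k) s := by
  rcases Fin.eq_self_or_eq_succAbove i k with rfl | ⟨k, rfl⟩
  · simpa using hasDerivAt_const s (1 : ℂ)
  · simpa using hx.model_apply k

lemma hasDerivAt_dhomog (i k : Fin (n + 1)) {v : ℝ → Model n} {v' : Model n} {s : ℝ}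
    (hv : HasDerivAt v v' s) : HasDerivAt (fun t => dhomog i (v t) k) (dhomog i v' k) s := by
  rcases Fin.eq_self_or_eq_succAbove i k with rfl | ⟨k, rfl⟩
  · simpa using hasDerivAt_const s (0 : ℂ)
  · simpa using hv.model_apply k

lemma hasDerivAt_transition (i j : Fin (n + 1)) {x : ℝ → Model n} {x' : Model n} {s : ℝ}
    (hx : HasDerivAt x x' s) (h : homog i (x s) j ≠ 0) :
    HasDerivAt (fun t => transition i j (x t)) (dTransition i j (x s) x') s := by
  refine hasDerivAt_model fun k => ?_
  refine ((hasDerivAt_homog i (j.succAbove k) hx).div (hasDerivAt_homog i j hx) h).congr_deriv ?_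
  simp only [dTransition, dAffine_apply]
  field_simp

/-- Chart changes are projective maps, so their second derivative is a symmetrised product of the
first derivative with one scalar form, here `d log` of the `j`-th homogeneous coordinate. It is the
same form by which `logForm` fails to be invariant. -/
lemma hasDerivAt_dTransition (i j : Fin (n + 1)) {x v : ℝ → Model n} {x' v' : Model n} {s : ℝ}
    (hx : HasDerivAt x x' s) (hv : HasDerivAt v v' s) (h : homog i (x s) j ≠ 0) :
    HasDerivAt (fun t => dTransition i j (x t) (v t))
      (dTransition i j (x s) v' - (dhomog i x' j / homog i (x s) j) • dTransition i j (x s) (v s)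
        - (dhomog i (v s) j / homog i (x s) j) • dTransition i j (x s) x') s := by
  refine hasDerivAt_model fun k => ?_
  have hX := hasDerivAt_homog i (j.succAbove k) hx
  have hXj := hasDerivAt_homog i j hx
  have hV := hasDerivAt_dhomog i (j.succAbove k) hv
  have hVj := hasDerivAt_dhomog i j hv
  refine ((hV.div hXj h).sub ((hX.mul hVj).div (hXj.pow 2) (pow_ne_zero 2 h))).congr_deriv ?_
  simp [dTransition]
  field_simp
  ring

/-- Covariant differentiation along a curve commutes with changes of charts. -/
lemma deriv_dTransition_add_christoffel (i j : Fin (n + 1)) {x v : ℝ → Model n} {s : ℝ}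
    (hx : DifferentiableAt ℝ x s) (hv : DifferentiableAt ℝ v s) (h : homog i (x s) j ≠ 0) :
    deriv (fun t => dTransition i j (x t) (v t)) s
      + christoffel fubiniStudy (transition i j (x s)) (deriv (fun t => transition i j (x t)) s)
        (dTransition i j (x s) (v s)) =
    dTransition i j (x s) (deriv v s + christoffel fubiniStudy (x s) (deriv x s) (v s)) := by
  have hn : ∀ u, dTransition i j (x s) (-u) = -dTransition i j (x s) u := fun u => by
    simpa using dTransition_smul i j (x s) u (-1)
  rw [(hasDerivAt_dTransition i j hx.hasDerivAt hv.hasDerivAt h).deriv,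
    (hasDerivAt_transition i j hx.hasDerivAt h).deriv]
  -- The correction to `logForm` cancels the second derivative of the chart change.
  simp only [christoffel_fubiniStudy, dTransition_add, hn, dTransition_smul,
    logForm_dTransition i j _ _ h]
  module

/-! ### The preferred charts -/

/-- The index of the preferred affine chart around `p`. -/
def chartIndex (p : CP n) : Fin (n + 1) := (exists_rep_ne_zero p).choose

lemma coord_eq (p q : CP n) : coord p q = affine (chartIndex p) (rep q) := rfl

lemma mem_chart_source_iff (p q : CP n) :
    q ∈ (chartAt (Model n) p).source ↔ rep q (chartIndex p) ≠ 0 := Iff.rfl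

lemma coord_ofAffine (p : CP n) (i : Fin (n + 1)) (z : Model n) :
    coord p (ofAffine i z) = transition i (chartIndex p) z := by
  obtain ⟨a, ha, h⟩ := rep_ofAffine i z
  rw [coord_eq, h, affine_smul _ a ha, transition]

lemma homog_coord_ne_zero {p q r : CP n} (hp : r ∈ (chartAt (Model n) p).source)
    (hq : r ∈ (chartAt (Model n) q).source) :
    homog (chartIndex p) (coord p r) (chartIndex q) ≠ 0 := by
  rw [mem_chart_source_iff] at hp hq
  rw [coord_eq, homog_affine _ _ hp]
  simp [hp, hq]

lemma coord_eq_transition {p q r : CP n} (hp : r ∈ (chartAt (Model n) p).source) :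
    coord q r = transition (chartIndex p) (chartIndex q) (coord p r) := by
  rw [mem_chart_source_iff] at hp
  rw [transition, coord_eq, coord_eq, homog_affine _ _ hp, affine_smul _ _ (inv_ne_zero hp)]

lemma fderiv_transition (i j : Fin (n + 1)) (z u : Model n) (h : homog i z j ≠ 0) :
    fderiv ℝ (transition i j) z u = dTransition i j z u := by
  have hx : HasDerivAt (fun t : ℝ => z + t • u) u 0 := by
    simpa using ((hasDerivAt_id (0 : ℝ)).smul_const u).const_add z
  have ho : IsOpen {z : Model n | homog i z j ≠ 0} :=
    isOpen_ne_fun (contDiff_homog i j).continuous continuous_const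
  have hd : DifferentiableAt ℝ (transition i j) z :=
    ((contDiffOn_transition i j).contDiffAt (ho.mem_nhds h)).differentiableAt (by simp)
  have h1 := HasFDerivAt.comp_hasDerivAt_of_eq (0 : ℝ) hd.hasFDerivAt hx (by simp)
  have h2 := hasDerivAt_transition i j hx (by simpa using h)
  have h3 := h1.unique h2
  simpa using h3

/-- Links the abstract coordinate change of the tangent bundle to the explicit `dTransition`, for
which invariance of metric and connection is known. -/
lemma tangentCoordChange_eq {p q r : CP n} (hp : r ∈ (chartAt (Model n) p).source)
    (hq : r ∈ (chartAt (Model n) q).source) (u : Model n) :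
    tangentCoordChange 𝓘(ℝ, Model n) p q r u =
      dTransition (chartIndex p) (chartIndex q) (coord p r) u := by
  have h : (extChartAt 𝓘(ℝ, Model n) q ∘ (extChartAt 𝓘(ℝ, Model n) p).symm)
      = transition (chartIndex p) (chartIndex q) := by
    ext1 z
    exact coord_ofAffine q _ z
  rw [tangentCoordChange_def, h, modelWithCornersSelf_coe, Set.range_id, fderivWithin_univ]
  exact fderiv_transition _ _ _ _ (homog_coord_ne_zero hp hq)

section

/-! ### Fields along curves -/

/-- The equation `∇G = 0` in coordinates, again a rational identity once real parts are written with
conjugates. -/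
lemma fderiv_fubiniStudy_eq_christoffel (z u v w : Model n) :
    fderiv ℝ fubiniStudy z u v w = fubiniStudy z (christoffel fubiniStudy z u v) w
      + fubiniStudy z v (christoffel fubiniStudy z u w) := by
  have h0 := rho_ne_zero z
  simp only [fderiv_fubiniStudy, christoffel_fubiniStudy, fubiniStudy_eq_re, fsHerm, logForm,
    inner_neg_left, inner_neg_right, inner_add_left, inner_add_right, inner_smul_left,
    inner_smul_right, map_div₀, conj_rho]
  rw [← Complex.add_re]
  refine Complex.ofReal_injective ?_
  rw [Complex.re_eq_add_conj, Complex.re_eq_add_conj]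
  simp only [map_sub, map_mul, map_div₀, map_add, map_neg, map_pow, conj_rho, inner_conj_symm,
    map_ofNat]
  field_simp
  ring

/-- Metric compatibility of the connection, in coordinates. -/
lemma hasDerivAt_fubiniStudy {x v w : ℝ → Model n} {s : ℝ} (hx : DifferentiableAt ℝ x s)
    (hv : DifferentiableAt ℝ v s) (hw : DifferentiableAt ℝ w s) :
    HasDerivAt (fun t => fubiniStudy (x t) (v t) (w t))
      (fubiniStudy (x s) (deriv v s + christoffel fubiniStudy (x s) (deriv x s) (v s)) (w s)
        + fubiniStudy (x s) (v s)
          (deriv w s + christoffel fubiniStudy (x s) (deriv x s) (w s))) s := by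
  have hG : HasDerivAt (fun t => fubiniStudy (x t)) (fderiv ℝ fubiniStudy (x s) (deriv x s)) s :=
    HasFDerivAt.comp_hasDerivAt (E := Model n →L[ℝ] Model n →L[ℝ] ℝ) s (l := fubiniStudy) (f := x)
      ((contDiff_fubiniStudy (n := n)).differentiable (by simp) (x s)).hasFDerivAt hx.hasDerivAt
  refine ((hG.clm_apply hv.hasDerivAt).clm_apply hw.hasDerivAt).congr_deriv ?_
  simp only [add_apply, map_add, fderiv_fubiniStudy_eq_christoffel]
  ring

variable {I : Set ℝ} {γ : ℝ → CP n} {V W : FieldAlong γ} {s t : ℝ}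

/-- Smoothness of a curve at a point, in the preferred affine chart. -/
def SmoothCurveAt (γ : ℝ → CP n) (s : ℝ) : Prop :=
  ContinuousAt γ s ∧ ContDiffAt ℝ ∞ (localCurve γ s) s

/-- Smoothness of a field along a curve at a point, in the preferred affine chart. -/
def SmoothFieldAt (γ : ℝ → CP n) (V : FieldAlong γ) (s : ℝ) : Prop :=
  ContDiffAt ℝ ∞ (localField γ V s) s

lemma _root_.ContMDiffOn.smoothCurveAt (hI : IsOpen I)
    (h : ContMDiffOn 𝓘(ℝ, ℝ) 𝓘(ℝ, Model n) ∞ γ I) (hs : s ∈ I) : SmoothCurveAt γ s := by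
  have h1 := contMDiffAt_iff_target.1 (h.contMDiffAt (hI.mem_nhds hs))
  exact ⟨h1.1, h1.2.contDiffAt⟩

lemma SmoothField.smoothFieldAt (hI : IsOpen I) (h : SmoothField I γ V) (hs : s ∈ I) :
    SmoothFieldAt γ V s := by
  have h1 := (Bundle.contMDiffAt_totalSpace.1 (h.contMDiffAt (hI.mem_nhds hs))).2
  exact h1.contDiffAt

lemma SmoothCurveAt.eventually_mem (h : SmoothCurveAt γ s) :
    ∀ᶠ t in 𝓝 s, γ t ∈ (chartAt (Model n) (γ s)).source :=
  h.1 (chart_source_mem_nhds (Model n) (γ s))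

lemma localField_self : localField γ V s s = components (V s) :=
  tangentCoordChange_self (I := 𝓘(ℝ, Model n)) (mem_extChartAt_source (γ s))

lemma localField_eq (ht : γ t ∈ (chartAt (Model n) (γ s)).source) :
    localField γ V s t = dTransition (chartIndex (γ t)) (chartIndex (γ s)) (coord (γ t) (γ t))
      (components (V t)) :=
  tangentCoordChange_eq (mem_chart_source (Model n) (γ t)) ht _

/-- The left side uses the chart preferred at `γ t`, which varies with `t`; the right side uses the
one fixed at `γ s`, where it can be differentiated in `t`. -/
lemma metric_eq (ht : γ t ∈ (chartAt (Model n) (γ s)).source) :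
    metric (γ t) (V t) (W t) =
      fubiniStudy (localCurve γ s t) (localField γ V s t) (localField γ W s t) := by
  have h := mem_chart_source (Model n) (γ t)
  rw [localField_eq ht, localField_eq ht, localCurve, coord_eq_transition h,
    fubiniStudy_dTransition _ _ _ _ _ (homog_coord_ne_zero h ht), metric]

lemma localField_change {r : ℝ} (hs : γ r ∈ (chartAt (Model n) (γ s)).source)
    (ht : γ r ∈ (chartAt (Model n) (γ t)).source) :
    localField γ V t r = dTransition (chartIndex (γ s)) (chartIndex (γ t)) (localCurve γ s r)
      (localField γ V s r) := by
  rw [localCurve, ← tangentCoordChange_eq hs ht]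
  refine (tangentCoordChange_comp (I := 𝓘(ℝ, Model n)) ⟨⟨?_, ?_⟩, ?_⟩).symm
  · exact mem_extChartAt_source (γ r)
  · simpa using hs
  · simpa using ht

/-- The covariant derivative may be computed in any of the charts. -/
lemma localField_covDeriv (hγ : ContinuousAt γ t)
    (hmem : γ t ∈ (chartAt (Model n) (γ s)).source)
    (hx : DifferentiableAt ℝ (localCurve γ s) t) (hv : DifferentiableAt ℝ (localField γ V s) t) :
    localField γ (covDeriv γ V) s t = deriv (localField γ V s) t
      + christoffel fubiniStudy (localCurve γ s t) (deriv (localCurve γ s) t)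
        (localField γ V s t) := by
  have hs : ∀ᶠ r in 𝓝 t, γ r ∈ (chartAt (Model n) (γ s)).source :=
    hγ ((chartAt (Model n) (γ s)).open_source.mem_nhds hmem)
  have ht : ∀ᶠ r in 𝓝 t, γ r ∈ (chartAt (Model n) (γ t)).source :=
    hγ (chart_source_mem_nhds (Model n) (γ t))
  have htt := mem_chart_source (Model n) (γ t)
  have hfield : localField γ V t =ᶠ[𝓝 t] fun r => dTransition (chartIndex (γ s))
      (chartIndex (γ t)) (localCurve γ s r) (localField γ V s r) := by
    filter_upwards [hs, ht] with r h1 h2 using localField_change h1 h2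
  have hcurve : localCurve γ t =ᶠ[𝓝 t] fun r => transition (chartIndex (γ s))
      (chartIndex (γ t)) (localCurve γ s r) := by
    filter_upwards [hs] with r h1 using coord_eq_transition h1
  have hcov : components (covDeriv γ V t) = dTransition (chartIndex (γ s)) (chartIndex (γ t))
      (localCurve γ s t) (deriv (localField γ V s) t
      + christoffel fubiniStudy (localCurve γ s t) (deriv (localCurve γ s) t)
        (localField γ V s t)) := by
    rw [← deriv_dTransition_add_christoffel _ _ hx hv (homog_coord_ne_zero hmem htt),
      ← hfield.deriv_eq, ← hcurve.deriv_eq, ← hfield.eq_of_nhds, ← hcurve.eq_of_nhds]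
    rfl
  rw [localField, hcov, localCurve, ← tangentCoordChange_eq hmem htt, tangentCoordChange_comp,
    tangentCoordChange_self]
  · simpa using hmem
  · refine ⟨⟨?_, ?_⟩, ?_⟩
    · simpa using hmem
    · exact mem_extChartAt_source (γ t)
    · simpa using hmem

lemma SmoothFieldAt.differentiableAt (h : SmoothFieldAt γ V s) :
    DifferentiableAt ℝ (localField γ V s) s := ContDiffAt.differentiableAt h (by simp)

lemma SmoothCurveAt.differentiableAt (h : SmoothCurveAt γ s) :
    DifferentiableAt ℝ (localCurve γ s) s := h.2.differentiableAt (by simp)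

lemma _root_.ContDiffAt.eventually_differentiableAt {F : Type*} [NormedAddCommGroup F]
    [NormedSpace ℝ F] {f : ℝ → F} (h : ContDiffAt ℝ ∞ f s) :
    ∀ᶠ t in 𝓝 s, DifferentiableAt ℝ f t :=
  ((h.of_le (m := 1) (by exact_mod_cast le_top)).eventually (by simp)).mono
    fun _ ht => ht.differentiableAt (by simp)

lemma _root_.ContDiffAt.deriv_smooth {F : Type*} [NormedAddCommGroup F]
    [NormedSpace ℝ F] {f : ℝ → F} (h : ContDiffAt ℝ ∞ f s) : ContDiffAt ℝ ∞ (deriv f) s :=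
  (h.fderiv_right (m := ∞) (by simp)).clm_apply contDiffAt_const

/-- Smoothness of the curve is required near `s`, because `covDeriv` must be rewritten in the one
chart around `γ s` at every nearby parameter. -/
lemma smoothFieldAt_covDeriv (hγ : ∀ᶠ t in 𝓝 s, SmoothCurveAt γ t)
    (hV : SmoothFieldAt γ V s) : SmoothFieldAt γ (covDeriv γ V) s := by
  have hs := hγ.self_of_nhds
  have key : localField γ (covDeriv γ V) s =ᶠ[𝓝 s] fun t => deriv (localField γ V s) t
      + christoffel fubiniStudy (localCurve γ s t) (deriv (localCurve γ s) t)
        (localField γ V s t) := by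
    filter_upwards [hγ, hs.eventually_mem, hs.2.eventually_differentiableAt,
      ContDiffAt.eventually_differentiableAt hV] with t h1 h2 h3 h4
    exact localField_covDeriv h1.1 h2 h3 h4
  refine ContDiffAt.congr_of_eventuallyEq ?_ key
  have hx := hs.2
  have hv : ContDiffAt ℝ ∞ (localField γ V s) s := hV
  have hlog : ∀ u : ℝ → Model n, ContDiffAt ℝ ∞ u s →
      ContDiffAt ℝ ∞ (fun t => logForm (localCurve γ s t) (u t)) s := fun u hu => by
    simp only [logForm, div_eq_mul_inv]
    exact (hx.inner ℂ hu).mul ((contDiff_rho.contDiffAt.comp s hx).inv (rho_ne_zero _))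
  simp only [christoffel_fubiniStudy]
  exact hv.deriv_smooth.add (((hlog _ hx.deriv_smooth).smul hv).add
    ((hlog _ hv).smul hx.deriv_smooth)).neg

lemma smoothFieldAt_complexStructure (hγ : SmoothCurveAt γ s) (hV : SmoothFieldAt γ V s) :
    SmoothFieldAt γ (fun t => complexStructure (γ t) (V t)) s := by
  refine ContDiffAt.congr_of_eventuallyEq (f := fun t => Complex.I • localField γ V s t)
    (ContDiffAt.const_smul _ hV) ?_
  filter_upwards [hγ.eventually_mem] with t ht
  rw [localField_eq ht, localField_eq ht, ← dTransition_smul]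
  rfl

/-- The Kähler property `∇J = 0`: chart changes are holomorphic, so `J` is multiplication by `i` in
every chart, and `Γ` is complex linear in its arguments. -/
lemma covDeriv_complexStructure (hγ : SmoothCurveAt γ s) (hV : SmoothFieldAt γ V s) :
    covDeriv γ (fun t => complexStructure (γ t) (V t)) s =
      complexStructure (γ s) (covDeriv γ V s) := by
  have h : localField γ (fun t => complexStructure (γ t) (V t)) s =ᶠ[𝓝 s]
      fun t => Complex.I • localField γ V s t := by
    filter_upwards [hγ.eventually_mem] with t ht
    rw [localField_eq ht, localField_eq ht, ← dTransition_smul]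
    rfl
  change deriv (localField γ (fun t => complexStructure (γ t) (V t)) s) s
    + christoffel fubiniStudy (localCurve γ s s) (deriv (localCurve γ s) s)
      (localField γ (fun t => complexStructure (γ t) (V t)) s s) = Complex.I • (deriv (localField γ V s) s
    + christoffel fubiniStudy (localCurve γ s s) (deriv (localCurve γ s) s)
      (localField γ V s s))
  rw [h.deriv_eq, h.eq_of_nhds]
  have hd : deriv (fun t => Complex.I • localField γ V s t) s
      = Complex.I • deriv (localField γ V s) s := deriv_fun_const_smul Complex.I hV.differentiableAt
  rw [hd]
  simp only [christoffel_fubiniStudy, logForm_smul]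
  module

lemma localField_smul (f : ℝ → ℝ) : localField γ (fun t => f t • V t) s =
    fun t => f t • localField γ V s t :=
  funext fun t => map_smul (tangentCoordChange 𝓘(ℝ, Model n) (γ t) (γ s) (γ t)) (f t) _

lemma localField_add : localField γ (fun t => V t + W t) s =
    fun t => localField γ V s t + localField γ W s t :=
  funext fun t => map_add (tangentCoordChange 𝓘(ℝ, Model n) (γ t) (γ s) (γ t)) _ _

lemma smoothFieldAt_smul {f : ℝ → ℝ} (hf : ContDiffAt ℝ ∞ f s) (hV : SmoothFieldAt γ V s) :
    SmoothFieldAt γ (fun t => f t • V t) s := by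
  rw [SmoothFieldAt, localField_smul]
  exact hf.smul hV

lemma smoothFieldAt_add (hV : SmoothFieldAt γ V s) (hW : SmoothFieldAt γ W s) :
    SmoothFieldAt γ (fun t => V t + W t) s := by
  rw [SmoothFieldAt, localField_add]
  exact ContDiffAt.add hV hW

lemma covDeriv_smul {f : ℝ → ℝ} {f' : ℝ} (hf : HasDerivAt f f' s) (hV : SmoothFieldAt γ V s) :
    covDeriv γ (fun t => f t • V t) s = f' • V s + f s • covDeriv γ V s := by
  have hd : deriv (fun t => f t • localField γ V s t) s
      = f s • deriv (localField γ V s) s + f' • localField γ V s s :=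
    (hf.smul hV.differentiableAt.hasDerivAt).deriv
  change deriv (localField γ (fun t => f t • V t) s) s
    + christoffel fubiniStudy (localCurve γ s s) (deriv (localCurve γ s) s)
      (localField γ (fun t => f t • V t) s s) = f' • components (V s) + f s • (deriv (localField γ V s) s
    + christoffel fubiniStudy (localCurve γ s s) (deriv (localCurve γ s) s)
      (localField γ V s s))
  rw [← localField_self, localField_smul, hd]
  simp only [christoffel_fubiniStudy, ← Complex.coe_smul (f s), logForm_smul]
  module

lemma covDeriv_add (hV : SmoothFieldAt γ V s) (hW : SmoothFieldAt γ W s) :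
    covDeriv γ (fun t => V t + W t) s = covDeriv γ V s + covDeriv γ W s := by
  have hd : deriv (fun t => localField γ V s t + localField γ W s t) s
      = deriv (localField γ V s) s + deriv (localField γ W s) s :=
    deriv_fun_add hV.differentiableAt hW.differentiableAt
  change deriv (localField γ (fun t => V t + W t) s) s
    + christoffel fubiniStudy (localCurve γ s s) (deriv (localCurve γ s) s)
      (localField γ (fun t => V t + W t) s s) = (deriv (localField γ V s) s
    + christoffel fubiniStudy (localCurve γ s s) (deriv (localCurve γ s) s)
      (localField γ V s s)) + (deriv (localField γ W s) s
    + christoffel fubiniStudy (localCurve γ s s) (deriv (localCurve γ s) s)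
      (localField γ W s s))
  rw [localField_add, hd]
  simp only [christoffel_fubiniStudy, logForm_add]
  module

lemma localField_congr (h : ∀ᶠ t in 𝓝 s, V t = W t) :
    localField γ V s =ᶠ[𝓝 s] localField γ W s := by
  filter_upwards [h] with t ht
  rw [localField, localField, ht]

lemma covDeriv_congr (h : ∀ᶠ t in 𝓝 s, V t = W t) : covDeriv γ V s = covDeriv γ W s := by
  rw [covDeriv, covDeriv, (localField_congr h).deriv_eq, (localField_congr h).eq_of_nhds]

/-- The Levi-Civita connection is compatible with the metric. -/
lemma hasDerivAt_metric (hγ : SmoothCurveAt γ s) (hV : SmoothFieldAt γ V s)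
    (hW : SmoothFieldAt γ W s) :
    HasDerivAt (fun t => metric (γ t) (V t) (W t))
      (metric (γ s) (covDeriv γ V s) (W s) + metric (γ s) (V s) (covDeriv γ W s)) s := by
  have h1 : ∀ᶠ t in 𝓝 s, metric (γ t) (V t) (W t) =
      fubiniStudy (localCurve γ s t) (localField γ V s t) (localField γ W s t) := by
    filter_upwards [hγ.eventually_mem] with t ht using metric_eq ht
  refine ((hasDerivAt_fubiniStudy hγ.differentiableAt hV.differentiableAt
    hW.differentiableAt).congr_of_eventuallyEq h1).congr_deriv ?_
  simp only [localField_self]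
  simp only [metric, covDeriv, localField_self]
  rfl

lemma contDiffAt_metric (hγ : SmoothCurveAt γ s) (hV : SmoothFieldAt γ V s)
    (hW : SmoothFieldAt γ W s) :
    ContDiffAt ℝ ∞ (fun t => metric (γ t) (V t) (W t)) s := by
  refine ContDiffAt.congr_of_eventuallyEq ?_
    (hγ.eventually_mem.mono fun t ht => metric_eq (V := V) (W := W) ht)
  exact ((contDiff_fubiniStudy.contDiffAt.comp s hγ.2).clm_apply hV).clm_apply hW

/-! ### Algebra of the metric and the complex structure -/

variable {p : CP n}

lemma metric_add_left (u v w : Tangent p) : metric p (u + v) w = metric p u w + metric p v w := by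
  have h : components (u + v) = components u + components v := rfl
  simp [metric, h]

lemma metric_smul_left (c : ℝ) (u w : Tangent p) : metric p (c • u) w = c * metric p u w := by
  have h : components (c • u) = c • components u := rfl
  simp [metric, h]

lemma metric_symm (u v : Tangent p) : metric p u v = metric p v u := fubiniStudy_symm _ _ _

lemma metric_add_right (u v w : Tangent p) : metric p u (v + w) = metric p u v + metric p u w := by
  rw [metric_symm, metric_add_left, metric_symm v, metric_symm w]

lemma metric_smul_right (c : ℝ) (u w : Tangent p) : metric p u (c • w) = c * metric p u w := by
  rw [metric_symm, metric_smul_left, metric_symm]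

lemma metric_zero_left (w : Tangent p) : metric p 0 w = 0 := by
  simpa using metric_smul_left 0 (0 : Tangent p) w

lemma complexStructure_add (u v : Tangent p) :
    complexStructure p (u + v) = complexStructure p u + complexStructure p v :=
  smul_add Complex.I (components u) (components v)

lemma complexStructure_smul (c : ℝ) (u : Tangent p) :
    complexStructure p (c • u) = c • complexStructure p u :=
  smul_comm Complex.I c (components u)

lemma metric_complexStructure (u v : Tangent p) :
    metric p (complexStructure p u) (complexStructure p v) = metric p u v :=
  fubiniStudy_I_I _ _ _

lemma complexStructure_complexStructure (u : Tangent p) :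
    complexStructure p (complexStructure p u) = (-1 : ℝ) • u := by
  change Complex.I • Complex.I • components u = (-1 : ℝ) • components u
  rw [smul_smul, Complex.I_mul_I]
  module

lemma metric_complexStructure_right (u v : Tangent p) :
    metric p u (complexStructure p v) = -metric p v (complexStructure p u) := by
  rw [← metric_complexStructure, complexStructure_complexStructure, metric_smul_right,
    metric_symm]
  ring

lemma riemann_of_orthonormal (u v : Tangent p) (hu : metric p u u = 1) (huv : metric p u v = 0) :
    riemann p u v u = (-1 : ℝ) • v
      + (3 * metric p u (complexStructure p v)) • complexStructure p u := by
  have h := curvature_fubiniStudy_of_orthonormal (coord p p) (components u) (components v) hu huv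
  rw [← neg_one_smul ℝ] at h
  exact h

end

/-! ### The algebra of the structure equations -/

/-- With `y = k₂ / σ`, eliminating `k₁` and `k₃` leaves `y⁴ + (3a² - 1) y² + 9a² = 0`. Its
discriminant is a square, hence nonnegative, which bounds `a`; its roots give the formula for `k₂`.
-/
lemma exists_sign_of_quadratic {a σ k₁ k₂ k₃ : ℝ} (ha : 0 < a) (hσ : 0 < σ) (hk₂ : 0 < k₂)
    (h1 : a ^ 2 + σ ^ 2 = 1) (h2 : k₂ * k₃ = 3 * a * σ) (h3 : k₁ ^ 2 + k₂ ^ 2 = 1 + 3 * a ^ 2)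
    (h4 : (k₁ - k₃) * σ = k₂ * a) :
    a ≤ (2 - √3) / √3 ∧ ∃ ε : ℝ, (ε = 1 ∨ ε = -1) ∧
      k₂ = σ / √2 * √(1 - 3 * a ^ 2 + ε * √(9 * a ^ 4 - 42 * a ^ 2 + 1)) := by
  obtain ⟨y, rfl⟩ : ∃ y, k₂ = y * σ := ⟨k₂ / σ, by field_simp⟩
  have hy : 0 < y := pos_of_mul_pos_left hk₂ hσ.le
  have hk₃ : y * k₃ = 3 * a := by
    apply mul_right_cancel₀ hσ.ne'
    linarith
  have hk₁ : k₁ = k₃ + y * a := by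
    apply mul_right_cancel₀ hσ.ne'
    linarith
  have hq : (y ^ 2) ^ 2 + (3 * a ^ 2 - 1) * y ^ 2 + 9 * a ^ 2 = 0 := by
    rw [hk₁] at h3
    linear_combination y ^ 2 * h3 - (y * k₃ + 3 * a + 2 * y ^ 2 * a) * hk₃ - (y ^ 4) * h1
  have hdisc : 9 * a ^ 4 - 42 * a ^ 2 + 1 = (2 * y ^ 2 + 3 * a ^ 2 - 1) ^ 2 := by
    linear_combination -4 * hq
  -- Otherwise every term of `hq` is nonnegative and `9a²` is positive.
  have hpos : 0 < 1 - 3 * a ^ 2 := by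
    by_contra! h
    nlinarith [pow_pos hy 2, pow_pos ha 2, pow_pos hy 4]
  constructor
  · have h6 : 6 * a ≤ 1 - 3 * a ^ 2 := by
      -- The discriminant is `(1 - 3a²)² - (6a)²`. The resulting bound reads `3(a + 1)² ≤ 4`.
      apply le_of_sq_le_sq _ hpos.le
      nlinarith [sq_nonneg (2 * y ^ 2 + 3 * a ^ 2 - 1)]
    have h3s : 0 < √3 := by positivity
    rw [le_div_iff₀ h3s]
    have h7 : (a + 1) * √3 ≤ 2 := by
      apply le_of_sq_le_sq _ zero_le_two
      rw [mul_pow, Real.sq_sqrt (by norm_num)]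
      nlinarith
    linarith
  -- The choice of root is the sign of `2y² + 3a² - 1`, whose absolute value is the square root of
  -- the discriminant.
  · have hfin : ∀ ε : ℝ, ε * |2 * y ^ 2 + 3 * a ^ 2 - 1| = 2 * y ^ 2 + 3 * a ^ 2 - 1 →
        y * σ = σ / √2 * √(1 - 3 * a ^ 2 + ε * √(9 * a ^ 4 - 42 * a ^ 2 + 1)) := by
      intro ε hε
      rw [hdisc, Real.sqrt_sq_eq_abs, hε,
        show 1 - 3 * a ^ 2 + (2 * y ^ 2 + 3 * a ^ 2 - 1) = 2 * y ^ 2 by ring,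
        Real.sqrt_mul (by norm_num), Real.sqrt_sq hy.le]
      field_simp
    rcases le_total 0 (2 * y ^ 2 + 3 * a ^ 2 - 1) with h | h
    · exact ⟨1, Or.inl rfl, hfin 1 (by rw [abs_of_nonneg h, one_mul])⟩
    · exact ⟨-1, Or.inr rfl, hfin (-1) (by rw [abs_of_nonpos h]; ring)⟩

/-- The product `t₁₂ t₁₄` is negative, so there are two sign patterns. In each, the quadratic is
applied to `a = |t₁₂|` and `σ = |t₁₄|`. -/
lemma exists_angle {k₁ k₂ k₃ t₁₂ t₁₄ t₂₃ t₃₄ : ℝ} (hk₁ : 0 < k₁) (hk₂ : 0 < k₂) (hk₃ : 0 < k₃)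
    (h1 : t₁₂ ^ 2 + t₁₄ ^ 2 = 1) (h2 : k₂ * k₃ = -3 * t₁₂ * t₁₄)
    (h3 : k₁ ^ 2 + k₂ ^ 2 = 1 + 3 * t₁₂ ^ 2) (h4 : t₁₂ * t₂₃ = t₁₄ * t₃₄)
    (h5 : k₁ * t₂₃ = k₂ * t₁₂ - k₃ * t₁₄) (h6 : k₂ * t₃₄ = k₁ * t₁₄ + k₃ * t₂₃) :
    ∃ α : ℝ, (t₁₂ = -Real.cos α ∧ t₃₄ = Real.cos α ∧ t₁₄ = -Real.sin α ∧ t₂₃ = Real.sin α) ∧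
      (k₃ = -(3 / (2 * k₂)) * Real.sin (2 * α) ∧
        k₁ = -(1 / Real.sin α) * (k₂ * Real.cos α - k₃ * Real.sin α)) ∧
      ((0 < t₁₂ ∧ α ∈ Set.Ioc (Real.pi / 2) (Real.arccos (-((2 - √3) / √3))) ∧
          ∃ ε : ℝ, (ε = 1 ∨ ε = -1) ∧
            k₂ = Real.sin α / √2 * √(1 - 3 * Real.cos α ^ 2
              + ε * √(9 * Real.cos α ^ 4 - 42 * Real.cos α ^ 2 + 1))) ∨
        (t₁₂ < 0 ∧ α ∈ Set.Ioc (3 * Real.pi / 2)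
            (Real.pi + Real.arccos (-((2 - √3) / √3))) ∧
          ∃ ε : ℝ, (ε = 1 ∨ ε = -1) ∧
            k₂ = -(Real.sin α / √2) * √(1 - 3 * Real.cos α ^ 2
              + ε * √(9 * Real.cos α ^ 4 - 42 * Real.cos α ^ 2 + 1)))) := by
  have hneg : t₁₂ * t₁₄ < 0 := by nlinarith [mul_pos hk₂ hk₃]
  have ht₁₄ : t₁₄ ≠ 0 := by rintro rfl; simp at hneg
  have hsq : t₂₃ ^ 2 = t₁₄ ^ 2 := by
    apply mul_left_cancel₀ hk₁.ne'
    -- The terms `k₃ t₁₄ t₂₃` from `h5` and `h6` cancel, and `h4` matches those with `k₂`.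
    linear_combination t₂₃ * h5 + k₂ * h4 + t₁₄ * h6
  have ht₂₃ : t₂₃ = -t₁₄ := by
    rcases sq_eq_sq_iff_eq_or_eq_neg.1 hsq with h | h
    -- If `t₂₃ = t₁₄`, then `h5` times `t₂₃` makes a sum of positive terms vanish.
    · exfalso
      subst h
      have h7 : k₁ * t₂₃ ^ 2 + k₃ * t₂₃ ^ 2 + k₂ * -(t₁₂ * t₂₃) = 0 := by
        linear_combination t₂₃ * h5
      have h8 : 0 < -(t₁₂ * t₂₃) := neg_pos.2 hneg
      have h9 : 0 < k₁ * t₂₃ ^ 2 + k₃ * t₂₃ ^ 2 + k₂ * -(t₁₂ * t₂₃) := by positivity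
      exact h9.ne' h7
    · exact h
  have ht₃₄ : t₃₄ = -t₁₂ := by
    apply mul_left_cancel₀ ht₁₄
    rw [← h4, ht₂₃]; ring
  have hformulas : ∀ α : ℝ, t₁₂ = -Real.cos α → t₁₄ = -Real.sin α →
      k₃ = -(3 / (2 * k₂)) * Real.sin (2 * α) ∧
        k₁ = -(1 / Real.sin α) * (k₂ * Real.cos α - k₃ * Real.sin α) := by
    intro α hc hs
    have hs0 : Real.sin α ≠ 0 := fun h => ht₁₄ (by rw [hs, h, neg_zero])
    rw [hc, hs] at h2
    rw [ht₂₃, hc, hs] at h5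
    rw [Real.sin_two_mul]
    constructor
    · field_simp
      linarith
    · field_simp
      linarith
  rcases lt_trichotomy t₁₂ 0 with h | h | h
  · have hpos : 0 < t₁₄ := pos_of_mul_neg_right hneg h.le
    have hle : -1 ≤ t₁₂ := by nlinarith
    -- Here `sin α = -t₁₄` is negative, outside the range of sines of `arccos`, hence the shift by
    -- `π`.
    have hcos : Real.cos (Real.pi + Real.arccos t₁₂) = -t₁₂ := by
      rw [add_comm, Real.cos_add_pi, Real.cos_arccos hle (by linarith)]
    have hsin : Real.sin (Real.pi + Real.arccos t₁₂) = -t₁₄ := by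
      rw [add_comm, Real.sin_add_pi, Real.sin_arccos, ← h1, add_sub_cancel_left,
        Real.sqrt_sq hpos.le]
    obtain ⟨hb, ε, hε, hk⟩ := exists_sign_of_quadratic (a := -t₁₂) (σ := t₁₄) (k₁ := k₁) (k₂ := k₂)
      (k₃ := k₃) (by linarith) hpos hk₂ (by linarith) (by linarith) (by linarith)
      (by rw [ht₂₃] at h5; linarith)
    refine ⟨Real.pi + Real.arccos t₁₂, ?_, hformulas _ (by rw [hcos, neg_neg])
      (by rw [hsin, neg_neg]), Or.inr ⟨h, ⟨?_, ?_⟩, ε, hε, ?_⟩⟩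
    · rw [hcos, hsin, ht₂₃, ht₃₄]; simp
    · have : Real.pi / 2 < Real.arccos t₁₂ := by
        rw [← Real.arccos_zero]
        exact Real.strictAntiOn_arccos ⟨hle, by linarith⟩ ⟨by norm_num, by norm_num⟩ h
      linarith
    · have := Real.antitone_arccos (show -((2 - √3) / √3) ≤ t₁₂ by linarith)
      linarith
    · rw [hcos, hsin, hk]; ring_nf
  · rw [h, zero_mul] at hneg; exact absurd hneg (lt_irrefl 0)
  · have hpos : t₁₄ < 0 := neg_of_mul_neg_right hneg h.le
    have hle : t₁₂ ≤ 1 := by nlinarith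
    have hcos : Real.cos (Real.arccos (-t₁₂)) = -t₁₂ :=
      Real.cos_arccos (by linarith) (by linarith)
    have hsin : Real.sin (Real.arccos (-t₁₂)) = -t₁₄ := by
      rw [Real.sin_arccos, ← h1, neg_sq, add_sub_cancel_left, ← neg_sq,
        Real.sqrt_sq (by linarith)]
    obtain ⟨hb, ε, hε, hk⟩ := exists_sign_of_quadratic (a := t₁₂) (σ := -t₁₄) (k₁ := k₁) (k₂ := k₂)
      (k₃ := k₃) h (by linarith) hk₂ (by linarith) (by linarith) (by linarith)
      (by rw [ht₂₃] at h5; linarith)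
    refine ⟨Real.arccos (-t₁₂), ?_, hformulas _ (by rw [hcos, neg_neg])
      (by rw [hsin, neg_neg]), Or.inl ⟨h, ⟨?_, ?_⟩, ε, hε, ?_⟩⟩
    · rw [hcos, hsin, ht₂₃, ht₃₄]; simp
    · rw [← Real.arccos_zero]
      exact Real.strictAntiOn_arccos ⟨by linarith, by linarith⟩ ⟨by norm_num, by norm_num⟩
        (by linarith)
    · exact Real.antitone_arccos (by linarith)
    · rw [hcos, hsin, hk]; ring_nf

section

/-! ### Frenet curves of osculating order four -/

variable {I : Set ℝ} {γ : ℝ → CP n} {E : ℕ → FieldAlong γ} {k : ℕ → ℝ → ℝ} {s : ℝ}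

lemma metric_frame_eq_torsion (i j : ℕ) :
    metric (γ s) (E i s) (complexStructure (γ s) (E j s)) = torsion γ E i j s := rfl

lemma torsion_swap (i j : ℕ) : torsion γ E i j s = -torsion γ E j i s :=
  metric_complexStructure_right _ _

lemma torsion_self (i : ℕ) : torsion γ E i i s = 0 := by
  have := torsion_swap (γ := γ) (E := E) (s := s) i i
  linarith

lemma exists_const_of_hasDerivAt_zero (hI : IsOpen I) (hI' : I.OrdConnected) (hne : I.Nonempty)
    {f : ℝ → ℝ} (hf : ∀ s ∈ I, HasDerivAt f 0 s) : ∃ c, ∀ s ∈ I, f s = c := by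
  obtain ⟨s₀, hs₀⟩ := hne
  exact ⟨f s₀, fun s hs => hI.is_const_of_deriv_eq_zero hI'.isPreconnected
    (fun t ht => (hf t ht).differentiableAt.differentiableWithinAt)
    (fun t ht => (hf t ht).deriv) hs hs₀⟩

namespace IsFrenetCurve


lemma smoothCurveAt (h : IsFrenetCurve I γ 4 E k) (hI : IsOpen I) (hs : s ∈ I) :
    SmoothCurveAt γ s := h.smooth.smoothCurveAt hI hs

lemma smoothFieldAt (h : IsFrenetCurve I γ 4 E k) (hI : IsOpen I) (hs : s ∈ I) {i : ℕ}
    (hi : i ∈ Finset.Icc 1 4) : SmoothFieldAt γ (E i) s :=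
  (h.smooth_frame i hi).smoothFieldAt hI hs

lemma covDeriv_one (h : IsFrenetCurve I γ 4 E k) (hs : s ∈ I) :
    covDeriv γ (E 1) s = k 1 s • E 2 s := by
  simpa using h.frenet s hs 1 (by simp)

lemma covDeriv_two (h : IsFrenetCurve I γ 4 E k) (hs : s ∈ I) :
    covDeriv γ (E 2) s = -(k 1 s) • E 1 s + k 2 s • E 3 s := by
  simpa using h.frenet s hs 2 (by simp)

lemma covDeriv_three (h : IsFrenetCurve I γ 4 E k) (hs : s ∈ I) :
    covDeriv γ (E 3) s = -(k 2 s) • E 2 s + k 3 s • E 4 s := by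
  simpa using h.frenet s hs 3 (by simp)

lemma covDeriv_four (h : IsFrenetCurve I γ 4 E k) (hs : s ∈ I) :
    covDeriv γ (E 4) s = -(k 3 s) • E 3 s := by
  simpa using h.frenet s hs 4 (by simp)

lemma metric_frame (h : IsFrenetCurve I γ 4 E k) (hs : s ∈ I) {i j : ℕ}
    (hi : i ∈ Finset.Icc 1 4) (hj : j ∈ Finset.Icc 1 4) :
    metric (γ s) (E i s) (E j s) = if i = j then 1 else 0 := h.orthonormal s hs i hi j hj

/-- Smoothness of the curvatures is not part of `IsFrenetCurve`; it follows from `k_i = ⟨∇E_i,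
E_{i+1}⟩`. -/
lemma contDiffAt_curvature (h : IsFrenetCurve I γ 4 E k) (hI : IsOpen I) (hs : s ∈ I) {i : ℕ}
    (hi : i ∈ Finset.Icc 1 3) : ContDiffAt ℝ ∞ (k i) s := by
  have hi' := Finset.mem_Icc.1 hi
  have hi4 : i ∈ Finset.Icc 1 4 := Finset.mem_Icc.2 ⟨by lia, by lia⟩
  have hj4 : i + 1 ∈ Finset.Icc 1 4 := Finset.mem_Icc.2 ⟨by lia, by lia⟩
  have hnear : ∀ᶠ t in 𝓝 s, t ∈ I := hI.mem_nhds hs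
  refine (contDiffAt_metric (h.smoothCurveAt hI hs)
    (smoothFieldAt_covDeriv (hnear.mono fun t ht => h.smoothCurveAt hI ht)
      (h.smoothFieldAt hI hs hi4)) (h.smoothFieldAt hI hs hj4)).congr_of_eventuallyEq ?_
  filter_upwards [hnear] with t ht
  rw [h.frenet t ht i hi4, metric_add_left, if_neg (by lia : i ≠ 4), metric_smul_left,
    h.metric_frame ht hj4 hj4, if_pos rfl]
  split_ifs with h1
  · rw [metric_zero_left]; ring
  · rw [metric_smul_left, h.metric_frame ht (Finset.mem_Icc.2 ⟨by lia, by lia⟩) hj4,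
      if_neg (by lia)]
    ring

/-- As both the metric and `J` are parallel, the derivative falls only on the frame fields. -/
lemma hasDerivAt_torsion (h : IsFrenetCurve I γ 4 E k) (hI : IsOpen I) (hs : s ∈ I) {i j : ℕ}
    (hi : i ∈ Finset.Icc 1 4) (hj : j ∈ Finset.Icc 1 4) :
    HasDerivAt (torsion γ E i j)
      (metric (γ s) (covDeriv γ (E i) s) (complexStructure (γ s) (E j s))
        + metric (γ s) (E i s) (complexStructure (γ s) (covDeriv γ (E j) s))) s := by
  have hc := h.smoothCurveAt hI hs
  rw [← covDeriv_complexStructure hc (h.smoothFieldAt hI hs hj)]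
  exact hasDerivAt_metric hc (h.smoothFieldAt hI hs hi)
    (smoothFieldAt_complexStructure hc (h.smoothFieldAt hI hs hj))

lemma hasDerivAt_torsion_one_two (h : IsFrenetCurve I γ 4 E k) (hI : IsOpen I) (hs : s ∈ I) :
    HasDerivAt (torsion γ E 1 2) (k 2 s * torsion γ E 1 3 s) s := by
  refine (h.hasDerivAt_torsion hI hs (by simp) (by simp)).congr_deriv ?_
  simp only [h.covDeriv_one hs, h.covDeriv_two hs, metric_smul_left, complexStructure_add,
    complexStructure_smul, metric_add_right, metric_smul_right, metric_frame_eq_torsion, torsion_self]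
  ring

lemma hasDerivAt_torsion_one_three (h : IsFrenetCurve I γ 4 E k) (hI : IsOpen I) (hs : s ∈ I) :
    HasDerivAt (torsion γ E 1 3)
      (k 1 s * torsion γ E 2 3 s - k 2 s * torsion γ E 1 2 s + k 3 s * torsion γ E 1 4 s) s := by
  refine (h.hasDerivAt_torsion hI hs (by simp) (by simp)).congr_deriv ?_
  simp only [h.covDeriv_one hs, h.covDeriv_three hs, metric_smul_left, complexStructure_add,
    complexStructure_smul, metric_add_right, metric_smul_right, metric_frame_eq_torsion]
  ring

lemma hasDerivAt_torsion_one_four (h : IsFrenetCurve I γ 4 E k) (hI : IsOpen I) (hs : s ∈ I) :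
    HasDerivAt (torsion γ E 1 4)
      (k 1 s * torsion γ E 2 4 s - k 3 s * torsion γ E 1 3 s) s := by
  refine (h.hasDerivAt_torsion hI hs (by simp) (by simp)).congr_deriv ?_
  simp only [h.covDeriv_one hs, h.covDeriv_four hs, metric_smul_left,
    complexStructure_smul, metric_smul_right, metric_frame_eq_torsion]
  ring

lemma hasDerivAt_torsion_two_four (h : IsFrenetCurve I γ 4 E k) (hI : IsOpen I) (hs : s ∈ I) :
    HasDerivAt (torsion γ E 2 4)
      (k 2 s * torsion γ E 3 4 s - k 1 s * torsion γ E 1 4 s - k 3 s * torsion γ E 2 3 s) s := by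
  refine (h.hasDerivAt_torsion hI hs (by simp) (by simp)).congr_deriv ?_
  simp only [h.covDeriv_two hs, h.covDeriv_four hs, metric_smul_left, metric_add_left,
    complexStructure_smul, metric_smul_right, metric_frame_eq_torsion]
  ring

/-! ### The tension and bitension fields in the Frenet frame -/

lemma tension_eq (h : IsFrenetCurve I γ 4 E k) (hI : IsOpen I) (hs : s ∈ I) :
    tension γ s = k 1 s • E 2 s := by
  have hnear : ∀ᶠ t in 𝓝 s, t ∈ I := hI.mem_nhds hs
  rw [tension, ← h.covDeriv_one hs]
  exact covDeriv_congr (hnear.mono fun t ht => (h.velocity_eq t ht).symm)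

lemma covDeriv_tension (h : IsFrenetCurve I γ 4 E k) (hI : IsOpen I) (hs : s ∈ I) :
    covDeriv γ (tension γ) s =
      (-(k 1 s) ^ 2) • E 1 s + (deriv (k 1) s • E 2 s + (k 1 s * k 2 s) • E 3 s) := by
  have hnear : ∀ᶠ t in 𝓝 s, t ∈ I := hI.mem_nhds hs
  rw [covDeriv_congr (hnear.mono fun t ht => h.tension_eq hI ht),
    covDeriv_smul ((h.contDiffAt_curvature hI hs (by simp)).differentiableAt (by simp)).hasDerivAt
      (h.smoothFieldAt hI hs (by simp)), h.covDeriv_two hs]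
  module

lemma covDeriv_covDeriv_tension (h : IsFrenetCurve I γ 4 E k) (hI : IsOpen I) (hs : s ∈ I) :
    covDeriv γ (covDeriv γ (tension γ)) s =
      (-3 * k 1 s * deriv (k 1) s) • E 1 s
      + (deriv (deriv (k 1)) s - k 1 s ^ 3 - k 1 s * k 2 s ^ 2) • E 2 s
      + (2 * deriv (k 1) s * k 2 s + k 1 s * deriv (k 2) s) • E 3 s
      + (k 1 s * k 2 s * k 3 s) • E 4 s := by
  have hnear : ∀ᶠ t in 𝓝 s, t ∈ I := hI.mem_nhds hs
  have c1 := h.contDiffAt_curvature hI hs (i := 1) (by simp)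
  have c2 := h.contDiffAt_curvature hI hs (i := 2) (by simp)
  have d1 := (c1.differentiableAt (by simp)).hasDerivAt
  have d2 := (c2.differentiableAt (by simp)).hasDerivAt
  have e1 := h.smoothFieldAt hI hs (i := 1) (by simp)
  have e2 := h.smoothFieldAt hI hs (i := 2) (by simp)
  have e3 := h.smoothFieldAt hI hs (i := 3) (by simp)
  have c3 : ContDiffAt ℝ ∞ (fun t => -(k 1 t) ^ 2) s := (c1.pow 2).neg
  have c4 : ContDiffAt ℝ ∞ (fun t => k 1 t * k 2 t) s := c1.mul c2
  have d3 : HasDerivAt (fun t => -(k 1 t) ^ 2) (-2 * k 1 s * deriv (k 1) s) s :=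
    (d1.pow 2).neg.congr_deriv (by simp)
  have d4 : HasDerivAt (fun t => k 1 t * k 2 t)
    (deriv (k 1) s * k 2 s + k 1 s * deriv (k 2) s) s := d1.mul d2
  have s2 := smoothFieldAt_smul c1.deriv_smooth e2
  have s3 := smoothFieldAt_smul c4 e3
  rw [covDeriv_congr (hnear.mono fun t ht => h.covDeriv_tension hI ht),
    covDeriv_add (smoothFieldAt_smul c3 e1) (smoothFieldAt_add s2 s3), covDeriv_add s2 s3,
    covDeriv_smul d3 e1,
    covDeriv_smul (c1.deriv_smooth.differentiableAt (by simp)).hasDerivAt e2,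
    covDeriv_smul d4 e3, h.covDeriv_one hs, h.covDeriv_two hs, h.covDeriv_three hs]
  module

/-- The biharmonic equation in terms of the Frenet frame. -/
lemma biharmonic_eq (h : IsFrenetCurve I γ 4 E k) (hI : IsOpen I) (hs : s ∈ I)
    (hb : bitension γ s = 0) :
    (-3 * k 1 s * deriv (k 1) s) • E 1 s
      + (deriv (deriv (k 1)) s - k 1 s ^ 3 - k 1 s * k 2 s ^ 2 + k 1 s) • E 2 s
      + (2 * deriv (k 1) s * k 2 s + k 1 s * deriv (k 2) s) • E 3 s
      + (k 1 s * k 2 s * k 3 s) • E 4 s =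
    (3 * k 1 s * torsion γ E 1 2 s) • complexStructure (γ s) (E 1 s) := by
  have h11 := h.metric_frame hs (i := 1) (j := 1) (by simp) (by simp)
  have h12 := h.metric_frame hs (i := 1) (j := 2) (by simp) (by simp)
  -- The curvature term is `-k_1 E_2 + 3 k_1 τ_12 J E_1`; its first part supplies the extra `+ k_1`
  -- in the `E_2` coefficient.
  have hR := riemann_of_orthonormal (p := γ s) (E 1 s) (k 1 s • E 2 s) (by simpa using h11)
    (by rw [metric_smul_right, h12]; simp)
  rw [complexStructure_smul, metric_smul_right, metric_frame_eq_torsion] at hR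
  have hb' := sub_eq_zero.1 hb
  rw [h.covDeriv_covDeriv_tension hI hs, h.tension_eq hI hs, ← h.velocity_eq s hs, hR] at hb'
  rw [← sub_eq_zero] at hb' ⊢
  rw [← hb']
  module

/-- Pairing with `E_1, …, E_4` gives the first four relations. Pairing with `J E_1` and `J E_3`
expresses `|J E_1| = 1` and `⟨J E_1, J E_3⟩ = 0` through the components of `J E_1` in the frame. -/
lemma biharmonic_components (h : IsFrenetCurve I γ 4 E k) (hI : IsOpen I) (hs : s ∈ I)
    (hb : bitension γ s = 0) :
    deriv (k 1) s = 0 ∧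
    deriv (deriv (k 1)) s - k 1 s ^ 3 - k 1 s * k 2 s ^ 2 + k 1 s =
      -(3 * k 1 s * torsion γ E 1 2 s ^ 2) ∧
    2 * deriv (k 1) s * k 2 s + k 1 s * deriv (k 2) s =
      -(3 * k 1 s * torsion γ E 1 2 s * torsion γ E 1 3 s) ∧
    k 2 s * k 3 s = -3 * torsion γ E 1 2 s * torsion γ E 1 4 s ∧
    torsion γ E 1 2 s ^ 2 + torsion γ E 1 3 s ^ 2 + torsion γ E 1 4 s ^ 2 = 1 ∧
    torsion γ E 1 2 s * torsion γ E 2 3 s = torsion γ E 1 4 s * torsion γ E 3 4 s := by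
  have heq := h.biharmonic_eq hI hs hb
  have hk1 : 0 < k 1 s := h.curvature_pos 1 (by simp) s hs
  have hk2 : 0 < k 2 s := h.curvature_pos 2 (by simp) s hs
  have hk3 : 0 < k 3 s := h.curvature_pos 3 (by simp) s hs
  have m := fun i j hi hj => h.metric_frame hs (i := i) (j := j) hi hj
  have key := fun X => congrArg (fun Y => metric (γ s) Y X) heq
  simp only [metric_add_left, metric_smul_left] at key
  have k1 := key (E 1 s)
  have k2 := key (E 2 s)
  have k3 := key (E 3 s)
  have k4 := key (E 4 s)
  have kJ1 := key (complexStructure (γ s) (E 1 s))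
  have kJ3 := key (complexStructure (γ s) (E 3 s))
  have t1 : ∀ i, metric (γ s) (complexStructure (γ s) (E 1 s)) (E i s) = -torsion γ E 1 i s :=
    fun i => by rw [metric_symm, metric_frame_eq_torsion, torsion_swap]
  rw [m 1 1 (by simp) (by simp), m 2 1 (by simp) (by simp), m 3 1 (by simp) (by simp),
    m 4 1 (by simp) (by simp), t1, torsion_self] at k1
  rw [m 1 2 (by simp) (by simp), m 2 2 (by simp) (by simp), m 3 2 (by simp) (by simp),
    m 4 2 (by simp) (by simp), t1] at k2
  rw [m 1 3 (by simp) (by simp), m 2 3 (by simp) (by simp), m 3 3 (by simp) (by simp),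
    m 4 3 (by simp) (by simp), t1] at k3
  rw [m 1 4 (by simp) (by simp), m 2 4 (by simp) (by simp), m 3 4 (by simp) (by simp),
    m 4 4 (by simp) (by simp), t1] at k4
  rw [metric_complexStructure, m 1 1 (by simp) (by simp)] at kJ1
  rw [metric_complexStructure, m 1 3 (by simp) (by simp)] at kJ3
  simp only [metric_frame_eq_torsion, torsion_self, torsion_swap 2 1, torsion_swap 3 1, torsion_swap 4 1,
    torsion_swap 4 3] at kJ1 kJ3
  norm_num at k1 k2 k3 k4 kJ1 kJ3
  have hd : deriv (k 1) s = 0 := by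
    rcases k1 with h | h
    · exact absurd h hk1.ne'
    · exact h
  have h4 : k 2 s * k 3 s = -3 * torsion γ E 1 2 s * torsion γ E 1 4 s := by
    apply mul_left_cancel₀ hk1.ne'
    linarith
  -- Forced by `k_2 k_3 > 0`; it allows division by the coefficient of `J E_1`.
  have h12 : torsion γ E 1 2 s ≠ 0 := fun h0 => by
    rw [h0] at h4
    simp [hk2.ne', hk3.ne'] at h4
  have hne : 3 * k 1 s * torsion γ E 1 2 s ≠ 0 := by positivity
  refine ⟨hd, by linarith, by linarith, h4, ?_, ?_⟩
  · apply mul_left_cancel₀ hne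
    rw [k2, k3, k4] at kJ1
    linear_combination kJ1
  · apply mul_left_cancel₀ hne
    rw [k2, k4, hd] at kJ3
    linear_combination -kJ3

/-- The curvatures and torsions of a biharmonic Frenet curve of order four are constant, and they
satisfy the structure equations. -/
lemma biharmonic_const (h : IsFrenetCurve I γ 4 E k) (hI : IsOpen I) (hI' : I.OrdConnected)
    (hne : I.Nonempty) (hb : ∀ s ∈ I, bitension γ s = 0) :
    ∃ k₁ k₂ k₃ t₁₂ t₁₄ t₂₃ t₃₄ : ℝ,
      (∀ s ∈ I, k 1 s = k₁ ∧ k 2 s = k₂ ∧ k 3 s = k₃ ∧ torsion γ E 1 2 s = t₁₂ ∧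
        torsion γ E 1 3 s = 0 ∧ torsion γ E 1 4 s = t₁₄ ∧ torsion γ E 2 3 s = t₂₃ ∧
        torsion γ E 2 4 s = 0 ∧ torsion γ E 3 4 s = t₃₄) ∧
      0 < k₁ ∧ 0 < k₂ ∧ 0 < k₃ ∧
      t₁₂ ^ 2 + t₁₄ ^ 2 = 1 ∧ k₂ * k₃ = -3 * t₁₂ * t₁₄ ∧ k₁ ^ 2 + k₂ ^ 2 = 1 + 3 * t₁₂ ^ 2 ∧
      t₁₂ * t₂₃ = t₁₄ * t₃₄ ∧ k₁ * t₂₃ = k₂ * t₁₂ - k₃ * t₁₄ ∧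
      k₂ * t₃₄ = k₁ * t₁₄ + k₃ * t₂₃ := by
  have hB := fun s hs => h.biharmonic_components hI hs (hb s hs)
  have hk1 : ∀ s ∈ I, 0 < k 1 s := h.curvature_pos 1 (by simp)
  have hk2 : ∀ s ∈ I, 0 < k 2 s := h.curvature_pos 2 (by simp)
  have hk3 : ∀ s ∈ I, 0 < k 3 s := h.curvature_pos 3 (by simp)
  have hd : ∀ i ∈ Finset.Icc 1 3, ∀ s ∈ I, HasDerivAt (k i) (deriv (k i) s) s := fun i hi s hs =>
    ((h.contDiffAt_curvature hI hs hi).differentiableAt (by simp)).hasDerivAt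
  have hnear : ∀ s ∈ I, ∀ᶠ t in 𝓝 s, t ∈ I := fun s hs => hI.mem_nhds hs
  -- A function that vanishes on `I` has zero derivative there.
  have hzero : ∀ {f : ℝ → ℝ} {f' s : ℝ}, s ∈ I → (∀ t ∈ I, f t = 0) → HasDerivAt f f' s →
      f' = 0 := fun hs hf hf' =>
    hf'.unique ((hasDerivAt_const _ (0 : ℝ)).congr_of_eventuallyEq ((hnear _ hs).mono hf))
  obtain ⟨k₁, hk₁⟩ := exists_const_of_hasDerivAt_zero hI hI' hne (f := k 1) fun s hs => by
    simpa [(hB s hs).1] using hd 1 (by simp) s hs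
  have hdd : ∀ s ∈ I, deriv (deriv (k 1)) s = 0 := fun s hs =>
    hzero hs (fun t ht => (hB t ht).1)
      ((h.contDiffAt_curvature hI hs (i := 1) (by simp)).deriv_smooth.differentiableAt
        (by simp)).hasDerivAt
  have hsum : ∀ s ∈ I, k 1 s ^ 2 + k 2 s ^ 2 = 1 + 3 * torsion γ E 1 2 s ^ 2 := fun s hs => by
    have h2 := (hB s hs).2.1
    rw [hdd s hs] at h2
    apply mul_left_cancel₀ (hk1 s hs).ne'
    linarith
  have hk2' : ∀ s ∈ I, deriv (k 2) s = -3 * torsion γ E 1 2 s * torsion γ E 1 3 s :=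
    fun s hs => by
    have h3 := (hB s hs).2.2.1
    rw [(hB s hs).1] at h3
    apply mul_left_cancel₀ (hk1 s hs).ne'
    linarith
  have ht12 : ∀ s ∈ I, torsion γ E 1 2 s ≠ 0 := fun s hs h0 => by
    have h4 := (hB s hs).2.2.2.1
    rw [h0] at h4
    simp [(hk2 s hs).ne', (hk3 s hs).ne'] at h4
  have ht13 : ∀ s ∈ I, torsion γ E 1 3 s = 0 := fun s hs => by
    -- Differentiating `hsum` gives `k_2 k_2' = 3 k_2 τ_12 τ_13`, while `hk2'` gives the opposite
    -- sign; hence the product vanishes.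
    have hf : HasDerivAt (fun t => k 1 t ^ 2 + k 2 t ^ 2 - (1 + 3 * torsion γ E 1 2 t ^ 2))
        (2 * k 1 s * deriv (k 1) s + 2 * k 2 s * deriv (k 2) s
          - 3 * (2 * torsion γ E 1 2 s * (k 2 s * torsion γ E 1 3 s))) s := by
      refine ((((hd 1 (by simp) s hs).pow 2).add ((hd 2 (by simp) s hs).pow 2)).sub
        ((((h.hasDerivAt_torsion_one_two hI hs).pow 2).const_mul 3).const_add 1)).congr_deriv ?_
      simp
    have h0 := hzero hs (fun t ht => sub_eq_zero.2 (hsum t ht)) hf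
    rw [(hB s hs).1, hk2' s hs] at h0
    have h1 : k 2 s * torsion γ E 1 2 s * torsion γ E 1 3 s = 0 := by linarith
    simpa [(hk2 s hs).ne', ht12 s hs] using h1
  obtain ⟨k₂, hk₂⟩ := exists_const_of_hasDerivAt_zero hI hI' hne (f := k 2) fun s hs => by
    simpa [hk2' s hs, ht13 s hs] using hd 2 (by simp) s hs
  obtain ⟨t₁₂, ht₁₂⟩ := exists_const_of_hasDerivAt_zero hI hI' hne (f := torsion γ E 1 2)
    fun s hs => by simpa [ht13 s hs] using h.hasDerivAt_torsion_one_two hI hs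
  have hunit : ∀ s ∈ I, torsion γ E 1 2 s ^ 2 + torsion γ E 1 4 s ^ 2 = 1 := fun s hs => by
    simpa [ht13 s hs] using (hB s hs).2.2.2.2.1
  have ht14 : ∀ s ∈ I, torsion γ E 1 4 s ≠ 0 := fun s hs h0 => by
    have h4 := (hB s hs).2.2.2.1
    rw [h0] at h4
    simp [(hk2 s hs).ne', (hk3 s hs).ne'] at h4
  have ht24 : ∀ s ∈ I, torsion γ E 2 4 s = 0 := fun s hs => by
    -- With `τ_13 = 0`, the derivative of the unit relation reduces to `2 k_1 τ_14 τ_24 = 0`.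
    have hf : HasDerivAt (fun t => torsion γ E 1 2 t ^ 2 + torsion γ E 1 4 t ^ 2 - 1)
        (2 * torsion γ E 1 2 s * (k 2 s * torsion γ E 1 3 s)
          + 2 * torsion γ E 1 4 s * (k 1 s * torsion γ E 2 4 s - k 3 s * torsion γ E 1 3 s)) s := by
      refine ((((h.hasDerivAt_torsion_one_two hI hs).pow 2).add
        ((h.hasDerivAt_torsion_one_four hI hs).pow 2)).sub_const 1).congr_deriv ?_
      simp
    have h0 := hzero hs (fun t ht => sub_eq_zero.2 (hunit t ht)) hf
    simpa [ht13 s hs, ht14 s hs, (hk1 s hs).ne'] using h0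
  obtain ⟨t₁₄, ht₁₄⟩ := exists_const_of_hasDerivAt_zero hI hI' hne (f := torsion γ E 1 4)
    fun s hs => by simpa [ht13 s hs, ht24 s hs] using h.hasDerivAt_torsion_one_four hI hs
  -- Since `τ_13` and `τ_24` vanish identically, their derivative formulas become algebraic
  -- relations. These determine `τ_23` and `τ_34` once `k_3` is known to be constant.
  have h13' : ∀ s ∈ I, k 1 s * torsion γ E 2 3 s - k 2 s * torsion γ E 1 2 s
      + k 3 s * torsion γ E 1 4 s = 0 := fun s hs =>
    hzero hs ht13 (h.hasDerivAt_torsion_one_three hI hs)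
  have h24' : ∀ s ∈ I, k 2 s * torsion γ E 3 4 s - k 1 s * torsion γ E 1 4 s
      - k 3 s * torsion γ E 2 3 s = 0 := fun s hs =>
    hzero hs ht24 (h.hasDerivAt_torsion_two_four hI hs)
  obtain ⟨s₀, hs₀⟩ := hne
  have hk₃ : ∀ s ∈ I, k 3 s = k 3 s₀ := fun s hs => by
    have h1 := (hB s hs).2.2.2.1
    have h2 := (hB s₀ hs₀).2.2.2.1
    rw [hk₂ s hs, ht₁₂ s hs, ht₁₄ s hs] at h1
    rw [hk₂ s₀ hs₀, ht₁₂ s₀ hs₀, ht₁₄ s₀ hs₀, ← h1] at h2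
    have h3 := hk2 s₀ hs₀
    rw [hk₂ s₀ hs₀] at h3
    exact (mul_left_cancel₀ h3.ne' h2).symm
  have ht₂₃ : ∀ s ∈ I, torsion γ E 2 3 s = torsion γ E 2 3 s₀ := fun s hs => by
    have h1 := h13' s hs
    have h2 := h13' s₀ hs₀
    have h3 := hk1 s₀ hs₀
    rw [hk₁ s hs, hk₂ s hs, hk₃ s hs, ht₁₂ s hs, ht₁₄ s hs] at h1
    rw [hk₁ s₀ hs₀] at h3
    rw [hk₁ s₀ hs₀, hk₂ s₀ hs₀, ht₁₂ s₀ hs₀, ht₁₄ s₀ hs₀] at h2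
    apply mul_left_cancel₀ h3.ne'
    linarith
  have ht₃₄ : ∀ s ∈ I, torsion γ E 3 4 s = torsion γ E 3 4 s₀ := fun s hs => by
    have h1 := h24' s hs
    have h2 := h24' s₀ hs₀
    have h3 := hk2 s₀ hs₀
    rw [hk₁ s hs, hk₂ s hs, hk₃ s hs, ht₂₃ s hs, ht₁₄ s hs] at h1
    rw [hk₂ s₀ hs₀] at h3
    rw [hk₁ s₀ hs₀, hk₂ s₀ hs₀, ht₁₄ s₀ hs₀] at h2
    apply mul_left_cancel₀ h3.ne'
    linarith
  refine ⟨k₁, k₂, k 3 s₀, t₁₂, t₁₄, torsion γ E 2 3 s₀, torsion γ E 3 4 s₀,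
    fun s hs => ⟨hk₁ s hs, hk₂ s hs, hk₃ s hs, ht₁₂ s hs, ht13 s hs, ht₁₄ s hs, ht₂₃ s hs,
      ht24 s hs, ht₃₄ s hs⟩, ?_⟩
  rw [← hk₁ s₀ hs₀, ← hk₂ s₀ hs₀, ← ht₁₂ s₀ hs₀, ← ht₁₄ s₀ hs₀]
  exact ⟨hk1 s₀ hs₀, hk2 s₀ hs₀, hk3 s₀ hs₀, hunit s₀ hs₀, (hB s₀ hs₀).2.2.2.1, hsum s₀ hs₀,
    (hB s₀ hs₀).2.2.2.2.2, by linarith [h13' s₀ hs₀], by linarith [h24' s₀ hs₀]⟩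

end IsFrenetCurve

end

end CPn

end

/-! ### The classification in osculating order four -/

theorem mainTheorem8 (n : ℕ) (I : Set ℝ) (hI_open : IsOpen I) (hI_interval : I.OrdConnected)
    (hI_nonempty : I.Nonempty) (γ : ℝ → CPn.CP n) (E : ℕ → CPn.FieldAlong γ) (k : ℕ → ℝ → ℝ)
    (hFrenet : CPn.IsFrenetCurve I γ 4 E k) (hBiharmonic : CPn.IsProperBiharmonic I γ) :
    CPn.IsHolomorphicHelix I γ 4 E k ∧
    ∃ α₀ : ℝ,
      (∀ s ∈ I,
        CPn.torsion γ E 1 2 s = -Real.cos α₀ ∧ CPn.torsion γ E 3 4 s = Real.cos α₀ ∧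
        CPn.torsion γ E 1 4 s = -Real.sin α₀ ∧ CPn.torsion γ E 2 3 s = Real.sin α₀ ∧
        CPn.torsion γ E 1 3 s = 0 ∧ CPn.torsion γ E 2 4 s = 0) ∧
      (∀ s ∈ I,
        k 3 s = -(3 / (2 * k 2 s)) * Real.sin (2 * α₀) ∧
        k 1 s = -(1 / Real.sin α₀) * (k 2 s * Real.cos α₀ - k 3 s * Real.sin α₀)) ∧
      (((∀ s ∈ I, 0 < CPn.torsion γ E 1 2 s) ∧
          α₀ ∈ Set.Ioc (Real.pi / 2) (Real.arccos (-((2 - √3) / √3))) ∧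
          ∃ ε : ℝ, (ε = 1 ∨ ε = -1) ∧ ∀ s ∈ I,
            k 2 s = Real.sin α₀ / √2 * √(1 - 3 * Real.cos α₀ ^ 2
              + ε * √(9 * Real.cos α₀ ^ 4 - 42 * Real.cos α₀ ^ 2 + 1))) ∨
        ((∀ s ∈ I, CPn.torsion γ E 1 2 s < 0) ∧
          α₀ ∈ Set.Ioc (3 * Real.pi / 2) (Real.pi + Real.arccos (-((2 - √3) / √3))) ∧
          ∃ ε : ℝ, (ε = 1 ∨ ε = -1) ∧ ∀ s ∈ I,
            k 2 s = -(Real.sin α₀ / √2) * √(1 - 3 * Real.cos α₀ ^ 2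
              + ε * √(9 * Real.cos α₀ ^ 4 - 42 * Real.cos α₀ ^ 2 + 1)))) := by
  obtain ⟨k₁, k₂, k₃, t₁₂, t₁₄, t₂₃, t₃₄, hc, hk₁, hk₂, hk₃, h1, h2, h3, h4, h5, h6⟩ :=
    hFrenet.biharmonic_const hI_open hI_interval hI_nonempty hBiharmonic.1
  obtain ⟨α, ⟨a1, a2, a3, a4⟩, hf, hcases⟩ := CPn.exists_angle hk₁ hk₂ hk₃ h1 h2 h3 h4 h5 h6
  have c1 := fun s hs => (hc s hs).1
  have c2 := fun s hs => (hc s hs).2.1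
  have c3 := fun s hs => (hc s hs).2.2.1
  have c12 := fun s hs => (hc s hs).2.2.2.1
  have c13 := fun s hs => (hc s hs).2.2.2.2.1
  have c14 := fun s hs => (hc s hs).2.2.2.2.2.1
  have c23 := fun s hs => (hc s hs).2.2.2.2.2.2.1
  have c24 := fun s hs => (hc s hs).2.2.2.2.2.2.2.1
  have c34 := fun s hs => (hc s hs).2.2.2.2.2.2.2.2
  refine ⟨⟨hFrenet, fun i hi => ?_, fun i j hi hij hj => ?_⟩, α, fun s hs => ?_, fun s hs => ?_, ?_⟩
  · obtain ⟨hi1, hi3⟩ := Finset.mem_Icc.1 hi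
    obtain rfl | rfl | rfl : i = 1 ∨ i = 2 ∨ i = 3 := by lia
    exacts [⟨k₁, hk₁, c1⟩, ⟨k₂, hk₂, c2⟩, ⟨k₃, hk₃, c3⟩]
  · obtain ⟨rfl, rfl⟩ | ⟨rfl, rfl⟩ | ⟨rfl, rfl⟩ | ⟨rfl, rfl⟩ | ⟨rfl, rfl⟩ | ⟨rfl, rfl⟩ :
      (i = 1 ∧ j = 2) ∨ (i = 1 ∧ j = 3) ∨ (i = 1 ∧ j = 4) ∨ (i = 2 ∧ j = 3) ∨
        (i = 2 ∧ j = 4) ∨ (i = 3 ∧ j = 4) := by lia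
    exacts [⟨_, c12⟩, ⟨_, c13⟩, ⟨_, c14⟩, ⟨_, c23⟩, ⟨_, c24⟩, ⟨_, c34⟩]
  · exact ⟨(c12 s hs).trans a1, (c34 s hs).trans a2, (c14 s hs).trans a3, (c23 s hs).trans a4,
      c13 s hs, c24 s hs⟩
  · rw [c1 s hs, c2 s hs, c3 s hs]
    exact hf
  · refine hcases.imp ?_ ?_
    · rintro ⟨ht, hα, ε, hε, hk⟩
      exact ⟨fun s hs => by rw [c12 s hs]; exact ht, hα, ε, hε, fun s hs => (c2 s hs).trans hk⟩
    · rintro ⟨ht, hα, ε, hε, hk⟩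
      exact ⟨fun s hs => by rw [c12 s hs]; exact ht, hα, ε, hε, fun s hs => (c2 s hs).trans hk⟩
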